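/- **Setting.** Let $G$ be a finite group with identity $e$ and $k$ a field. A $G$-crossed module is a $G$-graded vector space with a $G$-action such that $|h\triangleright v|=h|v|h^{-1}$ (equivalently a $D(G)$-module, or a $D^\vee(G)$-comodule); such modules form a braided category with $\Psi(v\otimes w)=|v|\triangleright w\otimes v$. Let $(\mathcal C,\pi)$ run over a family $S$ of pairs, where $\mathcal C\subset G$ is a conjugacy class with base point $r$, elements $q_c\in G$ ($c\in\mathcal C$) with $q_crq_c^{-1}=c$, $q_r=e$ are fixed, and $\pi$ is a finite-dimensional (for instance irreducible) matrix representation over $k$ of the centraliser $C_G$ of $r$. Put $\zeta_c(h)=q_{hch^{-1}}^{-1}hq_c\in C_G$. The $D(G)$-module $V_{\mathcal C,\pi}$ has basis $E_{ci}$ of grade $c$, with $h\triangleright E_{ci}=\sum_m\pi(\zeta_c(h))^m{}_i\,E_{hch^{-1}\,m}$. Repeated $i,j,\dots$ are summed below. **The braided-Lie algebra.** $\mathcal L=\bigoplus_{(\mathcal C,\pi)\in S}\mathcal L_{\mathcal C,\pi}$ with $\mathcal L_{\mathcal C,\pi}=\mathrm{End}(V_{\mathcal C,\pi})$ has the basis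 of matrix units $E_{ai}{}^{bj}$ of each block, with $$h\triangleright E_{ai}{}^{bj}=\pi(\zeta_a(h))^m{}_i\,\pi(\zeta_b(h)^{-1})^j{}_l\,E_{hah^{-1}m}{}^{hbh^{-1}l},\qquad |E_{ai}{}^{bj}|=ab^{-1},$$ $$\Delta E_{ai}{}^{bj}=\sum_{c,m}E_{ai}{}^{cm}\otimes E_{cm}{}^{bj},\qquad \epsilon(E_{ai}{}^{bj})=\delta_{a,b}\delta_i^j ,$$ $$[E_{ai}{}^{bj},y]=\delta_{ab^{-1}|y|,\,w}\;\pi(\zeta_a(w^{-1}))^j{}_i\;\,b^{-1}\triangleright y,\qquad w=b^{-1}|y|b,$$ for $y$ any matrix unit of any block. Its fundamental braiding is $\widetilde\Psi=([\ ,\ ]\otimes\mathrm{id})(\mathrm{id}\otimes\Psi)(\Delta\otimes\mathrm{id})$, and its braided enveloping algebra $U(\mathcal L)$ is the tensor algebra $T(\mathcal L)$ modulo the relations $\cdot\,\widetilde\Psi=\cdot$ on $\mathcal L\otimes\mathcal L$. **The R-matrix.** Let $D^\vee(G)$ have basis $\delta_g\otimes h$ and coquasitriangular structure $\mathcal R(\delta_g\otimes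 h\otimes\delta_u\otimes v)=\delta_{g,e}\delta_{h,u}$. Let $\rho^{ci}{}_{dj}=\sum_{n\in C_G}\pi(n)^i{}_j\,\delta_{q_cnq_d^{-1}}\otimes d$ be the matrix coefficients of $V_{\mathcal C,\pi}$. For two blocks $s,t\in S$ (possibly equal) put $\mathcal R^{x}{}_{y}{}^{z}{}_{w}=\mathcal R(\rho^x{}_y\otimes\rho^z{}_w)$, with $x,y$ labelling basis vectors of block $s$ and $z,w$ those of block $t$. **Braided matrices.** For such a family $R$ of R-matrices, $B(R)$ is the algebra generated by $u_x{}^y$ ($x,y$ basis labels of the same block) with relations $$\sum R^{y}{}_{a}{}^{i}{}_{b}\,R^{x}{}_{j}{}^{m}{}_{y}\;u_i{}^j\,u_m{}^l=\sum R^{r}{}_{n}{}^{p}{}_{b}\,R^{x}{}_{q}{}^{l}{}_{r}\;u_a{}^n\,u_p{}^q$$ for all basis labels $a,l$ of a block $s$ and $b,x$ of a block $t$, where $y,m,n,r$ are summed over block $s$ and $i,j,p,q$ over block $t$ (that is, $R_{21}u_1R_{12}u_2=u_2R_{21}u_1R_{12}$ for generators whose row index is the lower one). The braided-matrix bialgebra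 has the matrix coalgebra $\Delta u_x{}^y=\sum_z u_x{}^z\otimes u_z{}^y$, $\epsilon(u_x{}^y)=\delta_x^y$, and the braiding which on generators is $$\Psi(u_i{}^j\otimes u_m{}^l)=\sum R^{a}{}_{i}{}^{p}{}_{d}\,(R^{-1})^{v}{}_{a}{}^{b}{}_{q}\,R^{c}{}_{n}{}^{l}{}_{b}\,\widehat R^{j}{}_{c}{}^{d}{}_{m}\;u_p{}^q\otimes u_v{}^n ,$$ where $\widehat R$ is the second inverse, $\sum\widehat R^i{}_u{}^v{}_lR^u{}_j{}^m{}_v=\delta^i_j\delta^m_l$. **Statement.** 1. The R-matrices above are $$\mathcal R^{a'i'}{}_{b'j'}{}^{ck}{}_{dl}=\delta_{a',b'}\,\delta_{c,\,a'da'^{-1}}\,\delta^{i'}_{j'}\,\pi(\zeta_d(a'))^k{}_l ,$$ for primed labels in a block $(\mathcal C',\pi')$ and unprimed ones in a block $(\mathcal C,\pi)$. They solve the Yang–Baxter equation and are bi-invertible ($\mathcal R^{-1}$ and $\widehat{\mathcal R}$ exist). 2. The crossed-module and coalgebra structures of $\mathcal L$ extend to make both $U(\mathcal L)$ and $B(\mathcal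 R)$ (via $E_x{}^y\mapsto u_x{}^y$) bialgebras in the braided category of $G$-crossed modules; on $B(\mathcal R)$ this is the braided-matrix bialgebra structure, with the braiding given by $\mathcal R$ as above. 3. $E_x{}^y\mapsto u_x{}^y$ defines an isomorphism $U(\mathcal L)\cong B(\mathcal R)$ of algebras that is also an isomorphism of coalgebras and of $G$-crossed modules and respects the braidings, i.e. an isomorphism of braided bialgebras. In particular, for a single block, $U(\mathcal L_{\mathcal C,\pi})\cong B(\mathcal R)$. -/

import Mathlib

open scoped TensorProduct

namespace BraidedDouble

/-! ### Crossed modules over a finite group and their braiding -/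

section Crossed

/-- A `G`-crossed module, i.e. a left module over the quantum double `D(G)`: the group elements act
by `act` and `proj g` (the action of `δ_g`) is the projection onto the component of grade `g`. The
last axiom says `|h ▷ v| = h |v| h⁻¹`. -/
structure GCrossedModule (k G V : Type*) [Field k] [Group G] [Fintype G] [DecidableEq G]
    [AddCommGroup V] [Module k V] where
  act : G →* Module.End k V
  proj : G → Module.End k V
  proj_mul_proj : ∀ g h, proj g * proj h = if g = h then proj g else 0
  sum_proj : ∑ g, proj g = 1
  act_mul_proj : ∀ h g, act h * proj g = proj (h * g * h⁻¹) * act h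

variable {k G V W : Type*} [Field k] [Group G] [Fintype G] [DecidableEq G]
  [AddCommGroup V] [Module k V] [AddCommGroup W] [Module k W]

/-- The braiding `Ψ(v ⊗ w) = |v| ▷ w ⊗ v` of `G`-crossed modules. -/
noncomputable def GCrossedModule.braiding (M : GCrossedModule k G V) (N : GCrossedModule k G W) :
    V ⊗[k] W →ₗ[k] W ⊗[k] V :=
  ∑ g : G, TensorProduct.map (N.act g) (M.proj g) ∘ₗ (TensorProduct.comm k V W).toLinearMap

end Crossed

/-! ### Bialgebras in braided categories -/

section BraidedBialgebras

section Legs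

variable {k A : Type*} [Field k] [AddCommGroup A] [Module k A]

/-- A map `A ⊗ A → A ⊗ A` acting in the first two of three tensor factors. -/
noncomputable def leg12 (Ψ : A ⊗[k] A →ₗ[k] A ⊗[k] A) :
    A ⊗[k] (A ⊗[k] A) →ₗ[k] A ⊗[k] (A ⊗[k] A) :=
  (TensorProduct.assoc k A A A).toLinearMap ∘ₗ Ψ.rTensor A ∘ₗ
    (TensorProduct.assoc k A A A).symm.toLinearMap

/-- A map `A ⊗ A → A ⊗ A` acting in the last two of three tensor factors. -/
noncomputable def leg23 (Ψ : A ⊗[k] A →ₗ[k] A ⊗[k] A) :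
    A ⊗[k] (A ⊗[k] A) →ₗ[k] A ⊗[k] (A ⊗[k] A) := Ψ.lTensor A

/-- `m ⊗ id`. -/
noncomputable def mul12 (m : A ⊗[k] A →ₗ[k] A) : A ⊗[k] (A ⊗[k] A) →ₗ[k] A ⊗[k] A :=
  m.rTensor A ∘ₗ (TensorProduct.assoc k A A A).symm.toLinearMap

/-- `id ⊗ m`. -/
noncomputable def mul23 (m : A ⊗[k] A →ₗ[k] A) : A ⊗[k] (A ⊗[k] A) →ₗ[k] A ⊗[k] A :=
  m.lTensor A

/-- `Δ ⊗ id`. -/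
noncomputable def comul12 (Δ : A →ₗ[k] A ⊗[k] A) : A ⊗[k] A →ₗ[k] A ⊗[k] (A ⊗[k] A) :=
  (TensorProduct.assoc k A A A).toLinearMap ∘ₗ Δ.rTensor A

/-- `id ⊗ Δ`. -/
noncomputable def comul23 (Δ : A →ₗ[k] A ⊗[k] A) : A ⊗[k] A →ₗ[k] A ⊗[k] (A ⊗[k] A) :=
  Δ.lTensor A

/-- `ε ⊗ id`. -/
noncomputable def counit1 (ε : A →ₗ[k] k) : A ⊗[k] A →ₗ[k] A :=
  (TensorProduct.lid k A).toLinearMap ∘ₗ ε.rTensor A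

/-- `id ⊗ ε`. -/
noncomputable def counit2 (ε : A →ₗ[k] k) : A ⊗[k] A →ₗ[k] A :=
  (TensorProduct.rid k A).toLinearMap ∘ₗ ε.lTensor A

/-- `id ⊗ Ψ ⊗ id` on `(A ⊗ A) ⊗ (A ⊗ A)`. -/
noncomputable def middle (Ψ : A ⊗[k] A →ₗ[k] A ⊗[k] A) :
    (A ⊗[k] A) ⊗[k] (A ⊗[k] A) →ₗ[k] (A ⊗[k] A) ⊗[k] (A ⊗[k] A) :=
  (TensorProduct.assoc k A A (A ⊗[k] A)).symm.toLinearMap ∘ₗ (leg12 Ψ).lTensor A ∘ₗ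
    (TensorProduct.assoc k A A (A ⊗[k] A)).toLinearMap

end Legs

/-- A braided bialgebra structure on an algebra `A`: an invertible braiding `Ψ` of `A` with itself
and a coalgebra structure, such that product, unit, coproduct and counit commute with the braiding
and the coproduct and counit are algebra maps, where `A ⊗ A` has the braided tensor product
`(m ⊗ m)(id ⊗ Ψ ⊗ id)`. -/
structure BraidedBialgebra (k A : Type*) [Field k] [Ring A] [Algebra k A] extends
    Coalgebra k A where
  braiding : A ⊗[k] A →ₗ[k] A ⊗[k] A
  braiding_bijective : Function.Bijective braiding
  yang_baxter : leg12 braiding ∘ₗ leg23 braiding ∘ₗ leg12 braiding =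
    leg23 braiding ∘ₗ leg12 braiding ∘ₗ leg23 braiding
  braiding_mul_left : braiding ∘ₗ mul12 (LinearMap.mul' k A) =
    mul23 (LinearMap.mul' k A) ∘ₗ leg12 braiding ∘ₗ leg23 braiding
  braiding_mul_right : braiding ∘ₗ mul23 (LinearMap.mul' k A) =
    mul12 (LinearMap.mul' k A) ∘ₗ leg23 braiding ∘ₗ leg12 braiding
  braiding_one_left : ∀ a : A, braiding (1 ⊗ₜ a) = a ⊗ₜ 1
  braiding_one_right : ∀ a : A, braiding (a ⊗ₜ 1) = 1 ⊗ₜ a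
  comul_left_braiding : comul23 comul ∘ₗ braiding =
    leg12 braiding ∘ₗ leg23 braiding ∘ₗ comul12 comul
  comul_right_braiding : comul12 comul ∘ₗ braiding =
    leg23 braiding ∘ₗ leg12 braiding ∘ₗ comul23 comul
  counit_left_braiding : counit2 counit ∘ₗ braiding = counit1 counit
  counit_right_braiding : counit1 counit ∘ₗ braiding = counit2 counit
  comul_mul : comul ∘ₗ LinearMap.mul' k A =
    TensorProduct.map (LinearMap.mul' k A) (LinearMap.mul' k A) ∘ₗ middle braiding ∘ₗ
      TensorProduct.map comul comul
  comul_one : comul 1 = 1 ⊗ₜ 1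
  counit_mul : ∀ a b : A, counit (a * b) = counit a * counit b
  counit_one : counit 1 = 1

/-- A bialgebra in the braided category of `G`-crossed modules: a `G`-crossed module with an algebra
and a coalgebra structure whose structure maps are morphisms of crossed modules (where `G` acts
diagonally on tensor products, grades multiply, and the unit object has trivial action and grade
`1`), and which is a braided bialgebra for the braiding of crossed modules. -/
structure GCrossedBialgebra (k G A : Type*) [Field k] [Group G] [Fintype G] [DecidableEq G]
    [Ring A] [Algebra k A] extends BraidedBialgebra k A, GCrossedModule k G A where
  braiding_eq : braiding = toGCrossedModule.braiding toGCrossedModule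
  act_algebra_mul : ∀ (h : G) (a b : A), act h (a * b) = act h a * act h b
  act_algebra_one : ∀ h : G, act h 1 = 1
  proj_algebra_mul : ∀ (g : G) (a b : A), proj g (a * b) = ∑ h : G, proj h a * proj (h⁻¹ * g) b
  proj_algebra_one : ∀ g : G, proj g 1 = if g = 1 then 1 else 0
  comul_act : ∀ h : G, comul ∘ₗ act h = TensorProduct.map (act h) (act h) ∘ₗ comul
  comul_proj : ∀ g : G, comul ∘ₗ proj g =
    ∑ h : G, TensorProduct.map (proj h) (proj (h⁻¹ * g)) ∘ₗ comul
  counit_act : ∀ h : G, counit ∘ₗ act h = counit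
  counit_proj : ∀ g : G, counit ∘ₗ proj g = if g = 1 then counit else 0

end BraidedBialgebras

/-! ### The enveloping algebra of a braided-Lie algebra -/

section Enveloping

variable {k V : Type*} [Field k] [AddCommGroup V] [Module k V]

/-- The fundamental braiding `([ , ] ⊗ id)(id ⊗ Ψ)(Δ ⊗ id)` of a coalgebra `V` with bracket
`[ , ]` in a braided category with braiding `Ψ`. -/
noncomputable def fundamentalBraiding (Δ : V →ₗ[k] V ⊗[k] V) (br : V ⊗[k] V →ₗ[k] V)
    (Ψ : V ⊗[k] V →ₗ[k] V ⊗[k] V) : V ⊗[k] V →ₗ[k] V ⊗[k] V :=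
  mul12 br ∘ₗ leg23 Ψ ∘ₗ comul12 Δ

/-- The product `V ⊗ V → T(V)` of the tensor algebra in degree two. -/
noncomputable def tensorProd : V ⊗[k] V →ₗ[k] TensorAlgebra k V :=
  LinearMap.mul' k (TensorAlgebra k V) ∘ₗ
    TensorProduct.map (TensorAlgebra.ι k) (TensorAlgebra.ι k)

/-- The relations `· ∘ Ψ̃ = ·` of braided commutativity on the tensor algebra. -/
inductive EnvRel (Ψt : V ⊗[k] V →ₗ[k] V ⊗[k] V) : TensorAlgebra k V → TensorAlgebra k V → Prop
  | intro (x : V ⊗[k] V) : EnvRel Ψt (tensorProd (Ψt x)) (tensorProd x)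

/-- The tensor algebra modulo braided commutativity with respect to `Ψ̃`. -/
abbrev Env (Ψt : V ⊗[k] V →ₗ[k] V ⊗[k] V) := RingQuot (EnvRel Ψt)

/-- The canonical map of the generating space to the enveloping algebra. -/
noncomputable def Env.ι (Ψt : V ⊗[k] V →ₗ[k] V ⊗[k] V) : V →ₗ[k] Env Ψt :=
  (RingQuot.mkAlgHom k (EnvRel Ψt)).toLinearMap ∘ₗ TensorAlgebra.ι k

end Enveloping

/-! ### Braided matrices

`R s t i j m n` stands for the entry `R^i_j^m_n` of the R-matrix on the tensor product of the
blocks `s` and `t`, with `R (E_j ⊗ E_n) = ∑ E_i ⊗ E_m R^i_j^m_n`. With a single block this is an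
R-matrix on one vector space. -/

section BraidedMatrices

variable {k σ : Type*} [Field k] {I : σ → Type*} [∀ s, Fintype (I s)] [∀ s, DecidableEq (I s)]

/-- `R` as a matrix with rows `(i, m)` and columns `(j, n)`. -/
def flat (R : ∀ s t, I s → I s → I t → I t → k) (s t : σ) : Matrix (I s × I t) (I s × I t) k :=
  fun x y => R s t x.1 y.1 x.2 y.2

/-- `R` as a matrix with rows `(i, n)` and columns `(j, m)`. -/
def flatHat (R : ∀ s t, I s → I s → I t → I t → k) (s t : σ) :
    Matrix (I s × I t) (I s × I t) k :=
  fun x y => R s t x.1 y.1 y.2 x.2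

/-- The inverse `R⁻¹`. -/
noncomputable def rInv (R : ∀ s t, I s → I s → I t → I t → k) :
    ∀ s t, I s → I s → I t → I t → k :=
  fun s t i j m n => (flat R s t)⁻¹ (i, m) (j, n)

/-- The second inverse `R̂`, given by `∑ R̂^i_u^v_l R^u_j^m_v = δ^i_j δ^m_l`. -/
noncomputable def rHat (R : ∀ s t, I s → I s → I t → I t → k) :
    ∀ s t, I s → I s → I t → I t → k :=
  fun s t i j m n => (flatHat R s t)⁻¹ (i, n) (j, m)

/-- `R` is a bi-invertible solution of the Yang--Baxter equation `R₁₂R₁₃R₂₃ = R₂₃R₁₃R₁₂`. -/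
structure IsBiinvertible (R : ∀ s t, I s → I s → I t → I t → k) : Prop where
  yang_baxter : ∀ (s t u : σ) (i l : I s) (j m : I t) (h n : I u),
    ∑ a : I s, ∑ b : I t, ∑ c : I u, R s t i a j b * R s u a l h c * R t u b m c n =
    ∑ a : I s, ∑ b : I t, ∑ c : I u, R t u j b h c * R s u i a c n * R s t a l b m
  isUnit : ∀ s t, IsUnit (flat R s t)
  isUnit_hat : ∀ s t, IsUnit (flatHat R s t)

/-- Labels of the matrix units of all blocks. -/
abbrev Gen (I : σ → Type*) := Σ s, I s × I s

/-- The free generator with lower index `i` and upper index `j` in the block `s`. -/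
def freeGen (k : Type*) [Field k] {I : σ → Type*} (s : σ) (i j : I s) : FreeAlgebra k (Gen I) :=
  FreeAlgebra.ι k (⟨s, i, j⟩ : Gen I)

/-- The relations `R₂₁ u₁ R₁₂ u₂ = u₂ R₂₁ u₁ R₁₂` of braided matrices, in components and for
generators `u_i^j` whose row index is the lower one, so that upper and lower indices of `R` are
exchanged with respect to the usual form for generators `u^i_j`. -/
inductive BraidedMatrixRel (R : ∀ s t, I s → I s → I t → I t → k) :
    FreeAlgebra k (Gen I) → FreeAlgebra k (Gen I) → Prop
  | intro (s t : σ) (a l : I s) (b x : I t) : BraidedMatrixRel R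
      (∑ y : I s, ∑ i : I t, ∑ j : I t, ∑ m : I s,
        (R s t y a i b * R t s x j m y) • (freeGen k t i j * freeGen k s m l))
      (∑ n : I s, ∑ r : I s, ∑ p : I t, ∑ q : I t,
        (R s t r n p b * R t s x q l r) • (freeGen k s a n * freeGen k t p q))

/-- The algebra `B(R)` of braided matrices. -/
abbrev BraidedMatrices (R : ∀ s t, I s → I s → I t → I t → k) := RingQuot (BraidedMatrixRel R)

/-- The generator `u_i^j` of `B(R)` in the block `s`. -/
noncomputable def BraidedMatrices.u (R : ∀ s t, I s → I s → I t → I t → k) (s : σ) (i j : I s) :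
    BraidedMatrices R :=
  RingQuot.mkAlgHom k (BraidedMatrixRel R) (freeGen k s i j)

/-- A braided bialgebra structure on `B(R)` is the one of the braided-matrix bialgebra if on the
generators the coalgebra is the matrix coalgebra and the braiding is the one defined by `R`. (All
structure maps of a braided bialgebra are determined by their values on generators.) -/
structure IsBraidedMatrixBialgebra (R : ∀ s t, I s → I s → I t → I t → k)
    (D : BraidedBialgebra k (BraidedMatrices R)) : Prop where
  comul_u : ∀ s (i j : I s), D.comul (BraidedMatrices.u R s i j) =
    ∑ a : I s, BraidedMatrices.u R s i a ⊗ₜ[k] BraidedMatrices.u R s a j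
  counit_u : ∀ s (i j : I s), D.counit (BraidedMatrices.u R s i j) = if i = j then 1 else 0
  braiding_u : ∀ s t (i j : I s) (m l : I t),
    D.braiding (BraidedMatrices.u R s i j ⊗ₜ[k] BraidedMatrices.u R t m l) =
      ∑ p : I t, ∑ q : I t, ∑ v : I s, ∑ n : I s,
        (∑ a : I s, ∑ b : I t, ∑ c : I s, ∑ d : I t,
          R s t a i p d * rInv R s t v a b q * R s t c n l b * rHat R s t j c d m) •
        (BraidedMatrices.u R t p q ⊗ₜ[k] BraidedMatrices.u R s v n)

end BraidedMatrices

set_option linter.unusedSectionVars false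

/-! ### The blocks `V_{𝒞,π}` and the braided-Lie algebra `⨁ End(V_{𝒞,π})` -/

section Blocks

/-- The data of a `D(G)`-module `V_{𝒞,π}`: a base point `r` of a conjugacy class `𝒞`, a choice of
`q_c` with `q_c r q_c⁻¹ = c` for `c ∈ 𝒞` and `q_r = e`, and a finite-dimensional representation `π`
of the centraliser of `r`, in a basis. -/
structure Block (k G : Type*) [Field k] [Group G] where
  r : G
  q : {c : G // IsConj r c} → G
  q_conj : ∀ c, q c * r * (q c)⁻¹ = c
  q_base : q ⟨r, IsConj.refl r⟩ = 1
  dim : ℕ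
  π : Subgroup.centralizer ({r} : Set G) →* Matrix (Fin dim) (Fin dim) k

variable {k G σ : Type*} [Field k] [Group G]

namespace Block

/-- The conjugacy class `𝒞`. -/
abbrev Class (X : Block k G) := {c : G // IsConj X.r c}

/-- Labels of the basis `E_{ci} = c ⊗ v_i` of `V_{𝒞,π}`. -/
abbrev Idx (X : Block k G) := X.Class × Fin X.dim

/-- The conjugation action of `G` on `𝒞`. -/
def conj (X : Block k G) (h : G) (c : X.Class) : X.Class :=
  ⟨h * c * h⁻¹, c.2.trans (isConj_iff.2 ⟨h, rfl⟩)⟩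

/-- The cocycle `ζ_c(h) = q_{hch⁻¹}⁻¹ h q_c` with values in the centraliser. -/
def ζ (X : Block k G) (c : X.Class) (h : G) : Subgroup.centralizer ({X.r} : Set G) :=
  ⟨(X.q (X.conj h c))⁻¹ * h * X.q c, by
    rw [Subgroup.mem_centralizer_singleton_iff]
    have h1 := X.q_conj c
    have h2 := X.q_conj (X.conj h c)
    have h3 : X.q (X.conj h c) * X.r * (X.q (X.conj h c))⁻¹
        = h * (X.q c * X.r * (X.q c)⁻¹) * h⁻¹ := by rw [h1, h2]; rfl
    generalize X.q (X.conj h c) = x at h3 ⊢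
    generalize X.q c = y at h3 ⊢
    have h4 : X.r = x⁻¹ * (h * (y * X.r * y⁻¹) * h⁻¹) * x := by rw [← h3]; group
    conv_rhs => rw [h4]
    group⟩

theorem conj_one (X : Block k G) (c : X.Class) : X.conj 1 c = c := by
  apply Subtype.ext; simp [conj]

theorem conj_mul (X : Block k G) (g h : G) (c : X.Class) :
    X.conj (g * h) c = X.conj g (X.conj h c) := by
  apply Subtype.ext; simp [conj, mul_assoc]

theorem ζ_one (X : Block k G) (c : X.Class) : X.ζ c 1 = 1 := by
  apply Subtype.ext; simp [ζ, conj_one]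

theorem ζ_mul (X : Block k G) (g h : G) (c : X.Class) :
    X.ζ c (g * h) = X.ζ (X.conj h c) g * X.ζ c h := by
  apply Subtype.ext; simp [ζ, conj_mul, mul_assoc]

end Block

/-- The Hopf algebra `D^∨(G)` as a vector space, with basis `δ_g ⊗ h` labelled by `(g, h)`. -/
abbrev DualDouble (k G : Type*) [Field k] := G × G →₀ k

/-- The coquasitriangular structure `𝓡(δ_g ⊗ h, δ_u ⊗ v) = δ_{g,e} δ_{h,u}` of `D^∨(G)`. -/
noncomputable def coquasi (k G : Type*) [Field k] [Group G] [DecidableEq G] :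
    DualDouble k G →ₗ[k] DualDouble k G →ₗ[k] k :=
  Finsupp.linearCombination k fun x : G × G =>
    Finsupp.linearCombination k fun y : G × G => if x.1 = 1 ∧ x.2 = y.1 then (1 : k) else 0

open Classical in
/-- The matrix coefficients `ρ^{ci}_{dj} = ∑_n π(n)^i_j δ_{q_c n q_d⁻¹} ⊗ d` in `D^∨(G)`, with `n`
in the centraliser, of the comodule `V_{𝒞,π}`. -/
noncomputable def Block.coeff [Fintype G] (X : Block k G) (x y : X.Idx) : DualDouble k G :=
  ∑ n : Subgroup.centralizer ({X.r} : Set G),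
    Finsupp.single (X.q x.1 * n * (X.q y.1)⁻¹, (y.1 : G)) (X.π n x.2 y.2)

variable [Fintype G] [DecidableEq G]

/-- The R-matrix `𝓡^i_j^m_n = 𝓡(ρ^i_j ⊗ ρ^m_n)` of `D^∨(G)` on the blocks `s` and `t`. -/
noncomputable def rMatrix (X : σ → Block k G) (s t : σ) (i j : (X s).Idx) (m n : (X t).Idx) : k :=
  coquasi k G ((X s).coeff i j) ((X t).coeff m n)

/-- The vector space `𝓛 = ⨁ End(V_{𝒞,π})`, with basis the matrix units `E_x^y`, where
`x = (a, i)` and `y = (b, j)` run over the basis labels of the same block. -/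
abbrev LieSpace (X : σ → Block k G) := Gen (fun s => (X s).Idx) →₀ k

/-- The basis vector `E_x^y`. -/
noncomputable def E (X : σ → Block k G) (s : σ) (x y : (X s).Idx) : LieSpace X :=
  Finsupp.single (⟨s, x, y⟩ : Gen (fun s => (X s).Idx)) 1

/-- The grade `|E_{ai}^{bj}| = a b⁻¹`. -/
def grade (X : σ → Block k G) (z : Gen (fun s => (X s).Idx)) : G :=
  (z.2.1.1 : G) * (z.2.2.1 : G)⁻¹

/-- `h ▷ E_{ai}^{bj} = ∑ π(ζ_a(h))^m_i π(ζ_b(h)⁻¹)^j_l E_{hah⁻¹ m}^{hbh⁻¹ l}`. -/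
noncomputable def lieAct (X : σ → Block k G) (h : G) : Module.End k (LieSpace X) :=
  Finsupp.linearCombination k fun z : Gen (fun s => (X s).Idx) =>
    ∑ m : Fin (X z.1).dim, ∑ l : Fin (X z.1).dim,
      ((X z.1).π ((X z.1).ζ z.2.1.1 h) m z.2.1.2 *
        (X z.1).π ((X z.1).ζ z.2.2.1 h)⁻¹ z.2.2.2 l) •
      E X z.1 ((X z.1).conj h z.2.1.1, m) ((X z.1).conj h z.2.2.1, l)

/-- The projection of `𝓛` onto the component of grade `g`. -/
noncomputable def lieProj (X : σ → Block k G) (g : G) : Module.End k (LieSpace X) :=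
  Finsupp.linearCombination k fun z : Gen (fun s => (X s).Idx) =>
    if grade X z = g then E X z.1 z.2.1 z.2.2 else 0

theorem lieAct_E (X : σ → Block k G) (h : G) (s : σ) (x y : (X s).Idx) :
    lieAct X h (E X s x y) = ∑ m : Fin (X s).dim, ∑ l : Fin (X s).dim,
      ((X s).π ((X s).ζ x.1 h) m x.2 * (X s).π ((X s).ζ y.1 h)⁻¹ y.2 l) •
      E X s ((X s).conj h x.1, m) ((X s).conj h y.1, l) := by
  simp [lieAct, E]

theorem lieProj_E (X : σ → Block k G) (g : G) (s : σ) (x y : (X s).Idx) :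
    lieProj X g (E X s x y) =
      if (x.1 : G) * (y.1 : G)⁻¹ = g then E X s x y else 0 := by
  simp [lieProj, E, grade]

theorem lie_hom_ext (X : σ → Block k G) {f g : Module.End k (LieSpace X)}
    (h : ∀ s (x y : (X s).Idx), f (E X s x y) = g (E X s x y)) : f = g := by
  refine Finsupp.lhom_ext' fun z => LinearMap.ext_ring ?_
  obtain ⟨s, x, y⟩ := z
  exact h s x y

theorem sum_swap4 {ι M : Type*} [Fintype ι] [AddCommMonoid M] (F : ι → ι → ι → ι → M) :
    ∑ a, ∑ b, ∑ c, ∑ d, F a b c d = ∑ c, ∑ d, ∑ a, ∑ b, F a b c d := by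
  have h1 : ∀ a, ∑ b, ∑ c, ∑ d, F a b c d = ∑ c, ∑ d, ∑ b, F a b c d := fun a => by
    rw [Finset.sum_comm]
    exact Finset.sum_congr rfl fun c _ => Finset.sum_comm
  simp only [h1]
  rw [Finset.sum_comm]
  exact Finset.sum_congr rfl fun c _ => Finset.sum_comm

theorem lieAct_one (X : σ → Block k G) : lieAct X 1 = 1 := by
  refine lie_hom_ext X fun s x y => ?_
  rw [lieAct_E]
  simp [Block.ζ_one, Block.conj_one, Matrix.one_apply, ite_smul, Finset.sum_ite_eq]

theorem lieAct_mul (X : σ → Block k G) (g h : G) :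
    lieAct X (g * h) = lieAct X g * lieAct X h := by
  refine lie_hom_ext X fun s x y => ?_
  rw [Module.End.mul_apply, lieAct_E, lieAct_E]
  simp only [map_sum, map_smul, lieAct_E, Block.ζ_mul, Block.conj_mul, mul_inv_rev, map_mul,
    Matrix.mul_apply, Finset.smul_sum, smul_smul, Finset.sum_mul_sum, Finset.sum_smul]
  rw [sum_swap4]
  refine Finset.sum_congr rfl fun a _ => Finset.sum_congr rfl fun b _ =>
    Finset.sum_congr rfl fun c _ => Finset.sum_congr rfl fun d _ => ?_
  congr 1
  ring

theorem lieProj_mul (X : σ → Block k G) (g h : G) :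
    lieProj X g * lieProj X h = if g = h then lieProj X g else 0 := by
  refine lie_hom_ext X fun s x y => ?_
  rw [Module.End.mul_apply, lieProj_E]
  split_ifs with h1 h2 h2
  · rw [h2]
  · rw [lieProj_E, if_neg (fun h3 => h2 (h3.symm.trans h1))]; rfl
  · rw [map_zero, lieProj_E, if_neg (fun h3 => h1 (h3.trans h2))]
  · simp

theorem lieAct_mul_proj (X : σ → Block k G) (h g : G) :
    lieAct X h * lieProj X g = lieProj X (h * g * h⁻¹) * lieAct X h := by
  refine lie_hom_ext X fun s x y => ?_
  rw [Module.End.mul_apply, Module.End.mul_apply, lieProj_E, lieAct_E]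
  simp only [map_sum, map_smul, lieProj_E]
  have h1 : ((((X s).conj h x.1 : (X s).Class) : G) * (((X s).conj h y.1 : (X s).Class) : G)⁻¹
      = h * g * h⁻¹) ↔ (x.1 : G) * (y.1 : G)⁻¹ = g := by
    have : (((X s).conj h x.1 : (X s).Class) : G) * (((X s).conj h y.1 : (X s).Class) : G)⁻¹
      = h * ((x.1 : G) * (y.1 : G)⁻¹) * h⁻¹ := by
      simp [Block.conj, mul_assoc]
    rw [this]; simp
  simp only [h1]
  split_ifs with h2
  · rw [lieAct_E]
  · simp

/-- `𝓛 = ⨁ End(V_{𝒞,π})` as a `G`-crossed module. -/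
noncomputable def lieCrossed (X : σ → Block k G) : GCrossedModule k G (LieSpace X) where
  act :=
    { toFun := lieAct X
      map_one' := lieAct_one X
      map_mul' := lieAct_mul X }
  proj := lieProj X
  proj_mul_proj := lieProj_mul X
  sum_proj := by
    refine lie_hom_ext X fun s x y => ?_
    rw [LinearMap.sum_apply]
    simp [lieProj_E]
  act_mul_proj := lieAct_mul_proj X

/-- The matrix coproduct `Δ E_x^y = ∑_z E_x^z ⊗ E_z^y`. -/
noncomputable def lieComul (X : σ → Block k G) : LieSpace X →ₗ[k] LieSpace X ⊗[k] LieSpace X :=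
  Finsupp.linearCombination k fun z : Gen (fun s => (X s).Idx) =>
    ∑ w : (X z.1).Idx, E X z.1 z.2.1 w ⊗ₜ[k] E X z.1 w z.2.2

/-- The matrix counit `ε(E_x^y) = δ_{x,y}`. -/
noncomputable def lieCounit (X : σ → Block k G) : LieSpace X →ₗ[k] k :=
  Finsupp.linearCombination k fun z : Gen (fun s => (X s).Idx) =>
    if z.2.1 = z.2.2 then (1 : k) else 0

/-- The braided-Lie bracket: for `x = E_{ai}^{bj}` and `y = E_{ck}^{dl}`, with
`w = |b⁻¹ ▷ y| = b⁻¹ c d⁻¹ b`, one has `[x, y] = δ_{|x||y|, w} π(ζ_a(w⁻¹))^j_i (b⁻¹ ▷ y)`. -/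
noncomputable def lieBracket (X : σ → Block k G) : LieSpace X ⊗[k] LieSpace X →ₗ[k] LieSpace X :=
  TensorProduct.lift <| Finsupp.linearCombination k fun x : Gen (fun s => (X s).Idx) =>
    Finsupp.linearCombination k fun y : Gen (fun s => (X s).Idx) =>
      let b : G := x.2.2.1
      let w : G := b⁻¹ * grade X y * b
      if grade X x * grade X y = w then
        (X x.1).π ((X x.1).ζ x.2.1.1 w⁻¹) x.2.2.2 x.2.1.2 • lieAct X b⁻¹ (E X y.1 y.2.1 y.2.2)
      else 0

/-- The fundamental braiding of the braided-Lie algebra `𝓛` in the category of `G`-crossed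
modules. -/
noncomputable def lieBraiding (X : σ → Block k G) :
    LieSpace X ⊗[k] LieSpace X →ₗ[k] LieSpace X ⊗[k] LieSpace X :=
  fundamentalBraiding (lieComul X) (lieBracket X) ((lieCrossed X).braiding (lieCrossed X))

/-- The braided enveloping algebra `U(𝓛)`. -/
abbrev UL (X : σ → Block k G) := Env (lieBraiding X)

/-- The algebra `B(𝓡)` for the R-matrix of `D^∨(G)` on the given blocks. -/
abbrev BR (X : σ → Block k G) := BraidedMatrices (rMatrix X)

/-- The linear map `𝓛 → B(𝓡)`, `E_x^y ↦ u_x^y`. -/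
noncomputable def BR.ι (X : σ → Block k G) : LieSpace X →ₗ[k] BR X :=
  Finsupp.linearCombination k fun z : Gen (fun s => (X s).Idx) =>
    BraidedMatrices.u (rMatrix X) z.1 z.2.1 z.2.2

/-- A bialgebra in the category of `G`-crossed modules on an algebra `A` generated by the image of
`f : 𝓛 → A` extends the crossed-module and coalgebra structure of `𝓛`. -/
structure ExtendsLie (X : σ → Block k G) {A : Type*} [Ring A] [Algebra k A]
    (f : LieSpace X →ₗ[k] A) (D : GCrossedBialgebra k G A) : Prop where
  act : ∀ h : G, D.act h ∘ₗ f = f ∘ₗ lieAct X h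
  proj : ∀ g : G, D.proj g ∘ₗ f = f ∘ₗ lieProj X g
  comul : D.comul ∘ₗ f = TensorProduct.map f f ∘ₗ lieComul X
  counit : D.counit ∘ₗ f = lieCounit X

/-- An algebra isomorphism is an isomorphism of bialgebras in the category of `G`-crossed modules
if it respects the crossed-module and the coalgebra structures and the braidings. -/
structure IsCrossedBialgebraIso {A B : Type*} [Ring A] [Algebra k A] [Ring B] [Algebra k B]
    (D : GCrossedBialgebra k G A) (D' : GCrossedBialgebra k G B) (Φ : A ≃ₐ[k] B) : Prop where
  act : ∀ (h : G) (a : A), Φ (D.act h a) = D'.act h (Φ a)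
  proj : ∀ (g : G) (a : A), Φ (D.proj g a) = D'.proj g (Φ a)
  comul : ∀ a : A, TensorProduct.map Φ.toLinearMap Φ.toLinearMap (D.comul a) = D'.comul (Φ a)
  counit : ∀ a : A, D.counit a = D'.counit (Φ a)
  braiding : ∀ x : A ⊗[k] A, TensorProduct.map Φ.toLinearMap Φ.toLinearMap (D.braiding x) =
    D'.braiding (TensorProduct.map Φ.toLinearMap Φ.toLinearMap x)

end Blocks

end BraidedDouble

set_option linter.unusedSectionVars false

/-! Write ρ(h) for the matrix of h on a block V and |x| for the class element of a basis label x.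
Then 𝓡(E_y ⊗ E_w) = E_y ⊗ |y| ▷ E_w, that is, 𝓡 is block diagonal in the first factor with blocks
ρ(|y|), and both of its inverses have the entries with |y|⁻¹ in place of |y|. The action on 𝓛 = ⨁ V
⊗ V* is the product of two commuting actions, on the lower index (`lowerAct`) and on the upper index
(`upperAct`), and E_x^y has grade |x||y|⁻¹.

In these terms the relations of U(𝓛) and of B(𝓡) are both equivalent to `LieRel`: y · E_i^j = (|y| ▷
E_i^j) · (|j| ▷ y) for homogeneous y, where |y| acts on the lower index only. For U(𝓛) this holds
because the label contracted in ΔE_i^j cancels from the fundamental braiding (`lieBraiding_E`,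
`lieRel_iff_lieBraiding`); for B(𝓡) because the deltas in 𝓡 remove most of the sums and ρ is
invertible (`lieRel_iff_braidedMatrixLieRel`). The two algebras thus have the same universal
property, which gives the isomorphism.

The remaining structure is extended from generators by checking `LieRel`: for the action
(`LieRel.comp_lieAct`), for the grading, taken as an algebra map to A[G] (`lieRel_gradeMap`), for
the counit, and for the coproduct into the braided tensor square (`lieRel_comulMap`). The last is
the main computation; it uses that ∑ E_x^w ⊗ E_w^y is invariant under the action on the contracted
indices. Once Δ and ε are morphisms of algebras in the category, the braided bialgebra axioms are
formal, and the coalgebra axioms need checking only on generators. Products of crossed algebras are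
kept as bilinear maps, so that the braided product on A ⊗ A does not compete with the usual one.
Everything is done for an algebra A with a given isomorphism to U(𝓛), and so serves U(𝓛) and B(𝓡) at
once. -/

namespace BraidedDouble

/-! ### Algebras in the braided category of crossed modules -/

section General

variable {k G U V W : Type*} [Field k] [Group G] [Fintype G] [DecidableEq G]
  [AddCommGroup U] [Module k U] [AddCommGroup V] [Module k V] [AddCommGroup W] [Module k W]

namespace GCrossedModule

variable (L : GCrossedModule k G U) (M : GCrossedModule k G V) (N : GCrossedModule k G W)

/-- `v` is homogeneous of grade `g`. -/
def IsHomog (g : G) (v : V) : Prop := M.proj g v = v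

variable {L M N}

theorem proj_proj (g h : G) (v : V) :
    M.proj g (M.proj h v) = if g = h then M.proj g v else 0 := by
  rw [← Module.End.mul_apply, M.proj_mul_proj]
  split_ifs <;> rfl

theorem isHomog_proj (g : G) (v : V) : M.IsHomog g (M.proj g v) := by
  rw [IsHomog, proj_proj, if_pos rfl]

theorem sum_proj_apply (v : V) : ∑ g, M.proj g v = v := by
  rw [← LinearMap.sum_apply, M.sum_proj]; rfl

theorem IsHomog.proj_eq {g : G} {v : V} (hv : M.IsHomog g v) (h : G) :
    M.proj h v = if h = g then v else 0 := by
  rw [← hv, proj_proj]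
  split_ifs with h1
  · rw [h1]
  · rfl

theorem act_act (g h : G) (v : V) : M.act g (M.act h v) = M.act (g * h) v := by
  rw [map_mul]; rfl

theorem act_one (v : V) : M.act 1 v = v := by
  rw [map_one]; rfl

theorem act_proj (h g : G) (v : V) :
    M.act h (M.proj g v) = M.proj (h * g * h⁻¹) (M.act h v) := by
  rw [← Module.End.mul_apply, M.act_mul_proj]; rfl

theorem IsHomog.act {g : G} {v : V} (hv : M.IsHomog g v) (h : G) :
    M.IsHomog (h * g * h⁻¹) (M.act h v) := by
  rw [IsHomog, ← act_proj, hv]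

/-- A vector is the sum of its components. No case for zero is needed, since zero is homogeneous of
every grade. -/
theorem homog_induction (M : GCrossedModule k G V) {p : V → Prop}
    (h0 : ∀ g v, M.IsHomog g v → p v) (hadd : ∀ v w, p v → p w → p (v + w)) (v : V) : p v := by
  rw [← sum_proj_apply (M := M) v]
  exact Finset.sum_induction _ p hadd (h0 1 0 (map_zero _)) fun g _ => h0 g _ (isHomog_proj g v)

theorem hom_ext (M : GCrossedModule k G V) {f f' : V →ₗ[k] W}
    (h : ∀ g v, M.IsHomog g v → f v = f' v) : f = f' :=
  LinearMap.ext fun v => M.homog_induction h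
    (fun v w hv hw => by rw [map_add, map_add, hv, hw]) v

theorem tensor_ext (M : GCrossedModule k G V) (N : GCrossedModule k G W)
    {f f' : V ⊗[k] W →ₗ[k] U}
    (h : ∀ a b v w, M.IsHomog a v → N.IsHomog b w → f (v ⊗ₜ w) = f' (v ⊗ₜ w)) : f = f' :=
  TensorProduct.ext (M.hom_ext fun a v hv => N.hom_ext fun b w hw => h a b v w hv hw)

variable (M N) in
/-- The projections to the components of the tensor product. -/
noncomputable def tensorProj (g : G) : Module.End k (V ⊗[k] W) :=
  ∑ h : G, TensorProduct.map (M.proj h) (N.proj (h⁻¹ * g))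

theorem tensorProj_tmul {a b : G} {v : V} {w : W} (hv : M.IsHomog a v) (hw : N.IsHomog b w)
    (g : G) : tensorProj M N g (v ⊗ₜ w) = if g = a * b then v ⊗ₜ[k] w else 0 := by
  rw [tensorProj, LinearMap.sum_apply, Finset.sum_eq_single a]
  · rw [TensorProduct.map_tmul, hv.proj_eq, hw.proj_eq, if_pos rfl]
    by_cases h : g = a * b
    · rw [if_pos h, if_pos (by rw [h]; group)]
    · rw [if_neg h, if_neg (fun h1 => h (by rw [← h1]; group)), TensorProduct.tmul_zero]
  · intro c _ hc
    rw [TensorProduct.map_tmul, hv.proj_eq, if_neg hc, TensorProduct.zero_tmul]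
  · exact fun h => absurd (Finset.mem_univ _) h

variable (M N) in
/-- The tensor product of crossed modules: the action is diagonal and grades multiply. -/
noncomputable def tensor : GCrossedModule k G (V ⊗[k] W) where
  act :=
    { toFun := fun h => TensorProduct.map (M.act h) (N.act h)
      map_one' := by rw [map_one, map_one]; exact TensorProduct.map_id
      map_mul' := fun g h => by rw [map_mul, map_mul]; exact TensorProduct.map_comp _ _ _ _ }
  proj := tensorProj M N
  proj_mul_proj := fun g h => tensor_ext M N fun a b v w hv hw => by
    rw [Module.End.mul_apply, tensorProj_tmul hv hw]
    by_cases h1 : h = a * b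
    · rw [if_pos h1, tensorProj_tmul hv hw]
      by_cases h2 : g = a * b
      · rw [if_pos h2, if_pos (h2.trans h1.symm), tensorProj_tmul hv hw, if_pos h2]
      · rw [if_neg h2, if_neg (fun h3 => h2 (h3.trans h1))]; rfl
    · rw [if_neg h1, map_zero]
      split_ifs with h2
      · rw [tensorProj_tmul hv hw, if_neg (fun h3 => h1 (h2.symm.trans h3))]
      · rfl
  sum_proj := tensor_ext M N fun a b v w hv hw => by
    rw [LinearMap.sum_apply]
    simp [tensorProj_tmul hv hw]
  act_mul_proj := fun h g => tensor_ext M N fun a b v w hv hw => by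
    rw [Module.End.mul_apply, Module.End.mul_apply, tensorProj_tmul hv hw]
    simp only [MonoidHom.coe_mk, OneHom.coe_mk, TensorProduct.map_tmul]
    rw [tensorProj_tmul (hv.act h) (hw.act h)]
    have h1 : h * g * h⁻¹ = h * a * h⁻¹ * (h * b * h⁻¹) ↔ g = a * b := by
      rw [show h * a * h⁻¹ * (h * b * h⁻¹) = h * (a * b) * h⁻¹ by group]; simp
    simp only [h1]
    split_ifs <;> simp

theorem IsHomog.tmul {a b : G} {v : V} {w : W} (hv : M.IsHomog a v) (hw : N.IsHomog b w) :
    (M.tensor N).IsHomog (a * b) (v ⊗ₜ w) :=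
  (tensorProj_tmul hv hw _).trans (if_pos rfl)

theorem tensor_act_tmul (h : G) (v : V) (w : W) :
    (M.tensor N).act h (v ⊗ₜ w) = M.act h v ⊗ₜ N.act h w := rfl

theorem braiding_tmul {g : G} {v : V} (hv : M.IsHomog g v) (w : W) :
    M.braiding N (v ⊗ₜ w) = N.act g w ⊗ₜ v := by
  rw [braiding, LinearMap.sum_apply, Finset.sum_eq_single g]
  · simp [hv.proj_eq]
  · intro c _ hc
    simp [hv.proj_eq, hc]
  · exact fun h => absurd (Finset.mem_univ _) h

theorem braiding_bijective (M : GCrossedModule k G V) (N : GCrossedModule k G W) :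
    Function.Bijective (M.braiding N) := by
  -- The braiding leaves v unchanged, so |v| can still be read off afterwards and its action undone.
  let B : W ⊗[k] V →ₗ[k] V ⊗[k] W :=
    ∑ g : G, (TensorProduct.comm k W V).toLinearMap ∘ₗ TensorProduct.map (N.act g⁻¹) (M.proj g)
  have hB : ∀ (g : G) (v : V) (w : W), M.IsHomog g v → B (w ⊗ₜ v) = v ⊗ₜ N.act g⁻¹ w := by
    intro g v w hv
    simp only [B]
    rw [LinearMap.sum_apply, Finset.sum_eq_single g]
    · simp [hv.proj_eq]
    · intro c _ hc
      simp [hv.proj_eq, hc]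
    · exact fun h => absurd (Finset.mem_univ _) h
  refine Function.bijective_iff_has_inverse.2 ⟨B, fun x => ?_, fun x => ?_⟩
  · refine LinearMap.congr_fun (f := B ∘ₗ M.braiding N) (g := LinearMap.id)
      (tensor_ext M N fun a b v w hv hw => ?_) x
    rw [LinearMap.comp_apply, braiding_tmul hv, hB a _ _ hv, act_act, inv_mul_cancel, act_one]; rfl
  · refine LinearMap.congr_fun (f := M.braiding N ∘ₗ B) (g := LinearMap.id)
      (tensor_ext N M fun a b v w hv hw => ?_) x
    rw [LinearMap.comp_apply, hB b _ _ hw, braiding_tmul hw, act_act, mul_inv_cancel, act_one]; rfl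

/-- The trivial crossed module. -/
noncomputable def trivial (k G : Type*) [Field k] [Group G] [Fintype G] [DecidableEq G] :
    GCrossedModule k G k where
  act := 1
  proj := fun g => if g = 1 then 1 else 0
  proj_mul_proj := fun g h => by
    by_cases h1 : h = 1
    · by_cases h2 : g = 1
      · simp [h1, h2]
      · simp [h1, h2]
    · by_cases h2 : g = h
      · simp [h1, h2]
      · simp [h1, h2]
  sum_proj := by simp
  act_mul_proj := fun h g => by
    have h1 : h * g * h⁻¹ = 1 ↔ g = 1 := by simp
    simp only [h1, MonoidHom.one_apply, one_mul, mul_one]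

end GCrossedModule

/-- An algebra in the braided category of crossed modules, with its product as a bilinear map. -/
structure CrossedAlgebra (k G A : Type*) [Field k] [Group G] [Fintype G] [DecidableEq G]
    [AddCommGroup A] [Module k A] extends GCrossedModule k G A where
  mul : A →ₗ[k] A →ₗ[k] A
  one : A
  mul_assoc : ∀ a b c, mul (mul a b) c = mul a (mul b c)
  one_mul : ∀ a, mul one a = a
  mul_one : ∀ a, mul a one = a
  act_mul : ∀ h a b, act h (mul a b) = mul (act h a) (act h b)
  act_algebra_one : ∀ h, act h one = one
  homog_mul : ∀ g h a b, toGCrossedModule.IsHomog g a → toGCrossedModule.IsHomog h b →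
    toGCrossedModule.IsHomog (g * h) (mul a b)
  homog_one : toGCrossedModule.IsHomog 1 one

/-- Morphisms of algebras in the category of crossed modules. -/
structure IsCrossedHom (C : CrossedAlgebra k G V) (D : CrossedAlgebra k G W) (f : V →ₗ[k] W) :
    Prop where
  map_mul : ∀ a b, f (C.mul a b) = D.mul (f a) (f b)
  map_one : f C.one = D.one
  map_act : ∀ h a, f (C.act h a) = D.act h (f a)
  map_homog : ∀ g a, C.IsHomog g a → D.IsHomog g (f a)

theorem IsCrossedHom.comp {C : CrossedAlgebra k G U} {D : CrossedAlgebra k G V}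
    {E : CrossedAlgebra k G W} {f : V →ₗ[k] W} {f' : U →ₗ[k] V} (hf : IsCrossedHom D E f)
    (hf' : IsCrossedHom C D f') : IsCrossedHom C E (f ∘ₗ f') where
  map_mul a b := by simp only [LinearMap.comp_apply, hf'.map_mul, hf.map_mul]
  map_one := by simp only [LinearMap.comp_apply, hf'.map_one, hf.map_one]
  map_act h a := by simp only [LinearMap.comp_apply, hf'.map_act, hf.map_act]
  map_homog g a ha := hf.map_homog g _ (hf'.map_homog g a ha)

theorem IsCrossedHom.id (C : CrossedAlgebra k G V) : IsCrossedHom C C LinearMap.id :=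
  ⟨fun _ _ => rfl, rfl, fun _ _ => rfl, fun _ _ h => h⟩

namespace CrossedAlgebra

open GCrossedModule

variable (C : CrossedAlgebra k G V) (D : CrossedAlgebra k G W)

/-- The product of the braided tensor product of two algebras. -/
noncomputable def tensorMul : V ⊗[k] W →ₗ[k] V ⊗[k] W →ₗ[k] V ⊗[k] W :=
  TensorProduct.lift <| LinearMap.mk₂ k
    (fun a b => ∑ g : G, TensorProduct.map (C.mul a ∘ₗ C.act g) (D.mul (D.proj g b)))
    (fun a a' b => by
      simp only [map_add, LinearMap.add_comp, TensorProduct.map_add_left, Finset.sum_add_distrib])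
    (fun c a b => by
      simp only [map_smul, LinearMap.smul_comp, TensorProduct.map_smul_left, Finset.smul_sum])
    (fun a b b' => by
      simp only [map_add, TensorProduct.map_add_right, Finset.sum_add_distrib])
    (fun c a b => by
      simp only [map_smul, TensorProduct.map_smul_right, Finset.smul_sum])

variable {C D}

theorem tensorMul_tmul {g : G} (a c : V) {b : W} (hb : D.IsHomog g b) (d : W) :
    tensorMul C D (a ⊗ₜ b) (c ⊗ₜ d) = C.mul a (C.act g c) ⊗ₜ D.mul b d := by
  rw [tensorMul, TensorProduct.lift.tmul, LinearMap.mk₂_apply, LinearMap.sum_apply,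
    Finset.sum_eq_single g]
  · simp [hb.proj_eq]
  · intro c _ hc
    simp [hb.proj_eq, hc]
  · exact fun h => absurd (Finset.mem_univ _) h

theorem tensor_induction (M : GCrossedModule k G V) (N : GCrossedModule k G W)
    {p : V ⊗[k] W → Prop}
    (h : ∀ a b v w, M.IsHomog a v → N.IsHomog b w → p (v ⊗ₜ w))
    (hadd : ∀ x y, p x → p y → p (x + y)) (x : V ⊗[k] W) : p x := by
  induction x using TensorProduct.induction_on with
  | zero => simpa using h 1 1 0 0 (map_zero _) (map_zero _)
  | tmul v w =>
    refine M.homog_induction (p := fun v => p (v ⊗ₜ w)) (fun a v hv => ?_) (fun v v' h1 h2 => ?_) v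
    · refine N.homog_induction (p := fun w => p (v ⊗ₜ w)) (fun b w hw => ?_) (fun v v' h1 h2 => ?_) w
      · exact h a b v w hv hw
      · rw [TensorProduct.tmul_add]; exact hadd _ _ h1 h2
    · rw [TensorProduct.add_tmul]; exact hadd _ _ h1 h2
  | add x y hx hy => exact hadd x y hx hy

/-- Homogeneous elements of a tensor product are sums of products of homogeneous elements. -/
theorem tensor_homog_induction (M : GCrossedModule k G V) (N : GCrossedModule k G W)
    {p : V ⊗[k] W → Prop} {g : G}
    (h : ∀ a b v w, M.IsHomog a v → N.IsHomog b w → a * b = g → p (v ⊗ₜ w))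
    (hadd : ∀ x y, p x → p y → p (x + y)) (x : V ⊗[k] W) (hx : (M.tensor N).IsHomog g x) :
    p x := by
  have h0 : p 0 := by
    simpa using h g 1 0 0 (map_zero _) (map_zero _) (_root_.mul_one g)
  rw [← hx]
  clear hx
  induction x using tensor_induction M N with
  | h a b v w hv hw =>
    change p (tensorProj M N g (v ⊗ₜ w))
    rw [tensorProj_tmul hv hw]
    split_ifs with h1
    · exact h a b v w hv hw h1.symm
    · exact h0
  | hadd x y hx hy => rw [map_add]; exact hadd _ _ hx hy

variable (C D)

/-- The braided tensor product of algebras. -/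
noncomputable def tensor : CrossedAlgebra k G (V ⊗[k] W) where
  toGCrossedModule := C.toGCrossedModule.tensor D.toGCrossedModule
  mul := tensorMul C D
  one := C.one ⊗ₜ D.one
  mul_assoc x y z := by
    induction x using tensor_induction C.toGCrossedModule D.toGCrossedModule with
    | hadd x x' h h' => simp only [map_add, LinearMap.add_apply, h, h']
    | h g g' a b ha hb =>
    induction y using tensor_induction C.toGCrossedModule D.toGCrossedModule with
    | hadd x x' h h' => simp only [map_add, LinearMap.add_apply, h, h']
    | h h h' c d hc hd =>
    induction z using TensorProduct.induction_on with
    | zero => simp only [map_zero]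
    | add x x' h h' => simp only [map_add, h, h']
    | tmul e f =>
    rw [tensorMul_tmul a c hb, tensorMul_tmul _ _ (D.homog_mul _ _ _ _ hb hd),
      tensorMul_tmul c e hd, tensorMul_tmul a _ hb, C.act_mul, act_act, C.mul_assoc, D.mul_assoc]
  one_mul x := by
    induction x using TensorProduct.induction_on with
    | zero => simp only [map_zero]
    | add x x' h h' => simp only [map_add, h, h']
    | tmul e f => rw [tensorMul_tmul _ _ D.homog_one, C.one_mul, D.one_mul, act_one]
  mul_one x := by
    induction x using tensor_induction C.toGCrossedModule D.toGCrossedModule with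
    | hadd x x' h h' => simp only [map_add, LinearMap.add_apply, h, h']
    | h g g' a b ha hb => rw [tensorMul_tmul _ _ hb, C.act_algebra_one, C.mul_one, D.mul_one]
  act_mul h x y := by
    induction x using tensor_induction C.toGCrossedModule D.toGCrossedModule with
    | hadd x x' h h' => simp only [map_add, LinearMap.add_apply, h, h']
    | h g g' a b ha hb =>
    induction y using TensorProduct.induction_on with
    | zero => simp only [map_zero]
    | add x x' h h' => simp only [map_add, h, h']
    | tmul c d =>
    rw [tensorMul_tmul a c hb, tensor_act_tmul, tensor_act_tmul, tensor_act_tmul,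
      tensorMul_tmul _ _ (hb.act h), C.act_mul, D.act_mul, act_act, act_act]
    group
  act_algebra_one h := by rw [tensor_act_tmul, C.act_algebra_one, D.act_algebra_one]
  homog_mul g h x y hx hy := by
    refine tensor_homog_induction C.toGCrossedModule D.toGCrossedModule
      (p := fun x => (C.toGCrossedModule.tensor D.toGCrossedModule).IsHomog (g * h)
        (tensorMul C D x y))
      (fun g1 g2 a b ha hb e1 => ?_) (fun x x' h h' => ?_) x hx
    swap
    · rw [map_add, LinearMap.add_apply, IsHomog, map_add, h, h']
    refine tensor_homog_induction C.toGCrossedModule D.toGCrossedModule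
      (p := fun y => (C.toGCrossedModule.tensor D.toGCrossedModule).IsHomog (g * h)
        (tensorMul C D (a ⊗ₜ b) y))
      (fun h1 h2 c d hc hd e2 => ?_) (fun x x' h h' => ?_) y hy
    swap
    · rw [map_add, IsHomog, map_add, h, h']
    rw [tensorMul_tmul a c hb]
    have := (C.homog_mul _ _ _ _ ha (hc.act g2)).tmul (D.homog_mul _ _ _ _ hb hd)
    -- Moving c past b conjugates the grade of c by |b| = g2, which is just what makes the total
    -- grade multiplicative.
    rwa [show g1 * (g2 * h1 * g2⁻¹) * (g2 * h2) = g1 * g2 * (h1 * h2) by group, e1, e2] at this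
  homog_one := by simpa using C.homog_one.tmul D.homog_one

variable (k G) in
/-- The unit object as an algebra. -/
noncomputable def trivial : CrossedAlgebra k G k where
  toGCrossedModule := GCrossedModule.trivial k G
  mul := LinearMap.mul k k
  one := 1
  mul_assoc a b c := _root_.mul_assoc a b c
  one_mul := _root_.one_mul
  mul_one := _root_.mul_one
  act_mul _ _ _ := rfl
  act_algebra_one _ := rfl
  homog_mul g h a b ha hb := by
    simp only [GCrossedModule.IsHomog, GCrossedModule.trivial] at *
    by_cases hg : g = 1
    · by_cases hh : h = 1
      · simp [hg, hh]
      · rw [if_neg hh] at hb; simp [show b = 0 from hb.symm]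
    · rw [if_neg hg] at ha; simp [show a = 0 from ha.symm]
  homog_one := by simp [GCrossedModule.IsHomog, GCrossedModule.trivial]

/-- With the unit object as second factor this is one side of a counit law, which as a morphism of
algebras is determined by its values on generators. -/
theorem isCrossedHom_tmul_one :
    IsCrossedHom C (C.tensor D) ((TensorProduct.mk k V W).flip D.one) where
  map_mul a b := by
    simp only [LinearMap.flip_apply, TensorProduct.mk_apply, tensor]
    rw [tensorMul_tmul _ _ D.homog_one, act_one, D.one_mul]
  map_one := rfl
  map_act h a := by
    simp only [LinearMap.flip_apply, TensorProduct.mk_apply, tensor, tensor_act_tmul,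
      D.act_algebra_one]
  map_homog g a ha := by
    have := IsHomog.tmul ha D.homog_one
    rwa [_root_.mul_one] at this

theorem isCrossedHom_one_tmul : IsCrossedHom D (C.tensor D) (TensorProduct.mk k V W C.one) where
  map_mul a b := by
    simp only [TensorProduct.mk_apply, tensor]
    induction a using D.toGCrossedModule.homog_induction with
    | hadd v w h h' => simp only [map_add, LinearMap.add_apply, TensorProduct.tmul_add, h, h']
    | h0 g v hv => rw [tensorMul_tmul _ _ hv, C.act_algebra_one, C.one_mul]
  map_one := rfl
  map_act h a := by
    simp only [TensorProduct.mk_apply, tensor, tensor_act_tmul, C.act_algebra_one]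
  map_homog g a ha := by
    have := IsHomog.tmul C.homog_one ha
    rwa [_root_.one_mul] at this

end CrossedAlgebra

open GCrossedModule CrossedAlgebra

theorem IsCrossedHom.tensor {V' W' : Type*} [AddCommGroup V'] [Module k V'] [AddCommGroup W']
    [Module k W'] {C : CrossedAlgebra k G V} {D : CrossedAlgebra k G W}
    {C' : CrossedAlgebra k G V'} {D' : CrossedAlgebra k G W'} {f : V →ₗ[k] V'} {f' : W →ₗ[k] W'}
    (hf : IsCrossedHom C C' f) (hf' : IsCrossedHom D D' f') :
    IsCrossedHom (C.tensor D) (C'.tensor D') (TensorProduct.map f f') where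
  map_mul x y := by
    induction x using tensor_induction C.toGCrossedModule D.toGCrossedModule with
    | hadd x x' h h' => simp only [map_add, LinearMap.add_apply, h, h']
    | h g g' a b ha hb =>
    induction y using TensorProduct.induction_on with
    | zero => simp only [map_zero]
    | add x x' h h' => simp only [map_add, h, h']
    | tmul c d =>
    simp only [CrossedAlgebra.tensor, TensorProduct.map_tmul]
    rw [tensorMul_tmul _ _ hb, tensorMul_tmul _ _ (hf'.map_homog _ _ hb), TensorProduct.map_tmul,
      hf.map_mul, hf'.map_mul, hf.map_act]
  map_one := by
    simp only [CrossedAlgebra.tensor, TensorProduct.map_tmul, hf.map_one, hf'.map_one]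
  map_act h x := by
    induction x using TensorProduct.induction_on with
    | zero => simp only [map_zero]
    | add x x' h h' => simp only [map_add, h, h']
    | tmul c d =>
    simp only [CrossedAlgebra.tensor, tensor_act_tmul, TensorProduct.map_tmul, hf.map_act,
      hf'.map_act]
  map_homog g x hx := by
    refine tensor_homog_induction C.toGCrossedModule D.toGCrossedModule
      (p := fun x => (C'.tensor D').IsHomog g (TensorProduct.map f f' x))
      (fun g1 g2 a b ha hb e1 => ?_) (fun x x' h h' => by rw [map_add, IsHomog, map_add, h, h']) x hx
    rw [← e1]
    exact IsHomog.tmul (hf.map_homog _ _ ha) (hf'.map_homog _ _ hb)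

/-- In both bracketings the first factor a' is acted on by |b||c| and b' by |c|. This makes
coassociativity an equation between algebra morphisms. -/
theorem isCrossedHom_assoc (C : CrossedAlgebra k G U) (D : CrossedAlgebra k G V)
    (E : CrossedAlgebra k G W) :
    IsCrossedHom ((C.tensor D).tensor E) (C.tensor (D.tensor E))
      (TensorProduct.assoc k U V W).toLinearMap where
  map_mul x y := by
    induction x using tensor_induction (C.tensor D).toGCrossedModule E.toGCrossedModule with
    | hadd x x' h h' => simp only [map_add, LinearMap.add_apply, h, h']
    | h g g3 x c hx hc =>
    clear hx
    induction x using tensor_induction C.toGCrossedModule D.toGCrossedModule with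
    | hadd x x' h h' => simp only [map_add, TensorProduct.add_tmul, LinearMap.add_apply, h, h']
    | h g1 g2 a b ha hb =>
    induction y using TensorProduct.induction_on with
    | zero => simp only [map_zero]
    | add x x' h h' => simp only [map_add, h, h']
    | tmul y c' =>
    induction y using TensorProduct.induction_on with
    | zero => simp only [map_zero, TensorProduct.zero_tmul]
    | add x x' h h' => simp only [map_add, TensorProduct.add_tmul, h, h']
    | tmul a' b' =>
    have h1 := tensorMul_tmul (C := C.tensor D) (D := E) (a ⊗ₜ b) (a' ⊗ₜ b') hc c'
    have h2 := tensorMul_tmul (C := C) (D := D) a (C.act g3 a') hb (D.act g3 b')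
    have h3 := tensorMul_tmul (C := C) (D := D.tensor E) a a' (hb.tmul hc) (b' ⊗ₜ c')
    have h4 := tensorMul_tmul (C := D) (D := E) b b' hc c'
    change (TensorProduct.assoc k U V W) (tensorMul (C.tensor D) E _ _) =
      tensorMul C (D.tensor E) (a ⊗ₜ (b ⊗ₜ c)) (a' ⊗ₜ (b' ⊗ₜ c'))
    rw [h1, h3]
    change (TensorProduct.assoc k U V W) (tensorMul C D (a ⊗ₜ b) (C.act g3 a' ⊗ₜ D.act g3 b') ⊗ₜ _)
      = _ ⊗ₜ (tensorMul D E _ _)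
    rw [h2, h4, TensorProduct.assoc_tmul, act_act]
  map_one := rfl
  map_act h x := by
    refine LinearMap.congr_fun (f := (TensorProduct.assoc k U V W).toLinearMap ∘ₗ
      ((C.tensor D).tensor E).act h) (g := (C.tensor (D.tensor E)).act h ∘ₗ
        (TensorProduct.assoc k U V W).toLinearMap) ?_ x
    exact TensorProduct.ext_threefold fun a b c => rfl
  map_homog g x hx := by
    refine tensor_homog_induction (C.tensor D).toGCrossedModule E.toGCrossedModule
      (p := fun x => (C.tensor (D.tensor E)).IsHomog g (TensorProduct.assoc k U V W x))
      (fun g1 g2 x c hx hc e1 => ?_) (fun x x' h h' => by rw [map_add, IsHomog, map_add, h, h']) x hx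
    refine tensor_homog_induction C.toGCrossedModule D.toGCrossedModule
      (p := fun x => (C.tensor (D.tensor E)).IsHomog g (TensorProduct.assoc k U V W (x ⊗ₜ c)))
      (fun g3 g4 a b ha hb e2 => ?_)
      (fun x x' h h' => by rw [TensorProduct.add_tmul, map_add, IsHomog, map_add, h, h']) x hx
    rw [← e1, ← e2, _root_.mul_assoc]
    exact IsHomog.tmul ha (hb.tmul hc)

end General

/-! ### The matrices of the group action on a block -/

section BlockRep

variable {k G σ : Type*} [Field k] [Group G] [Fintype G] [DecidableEq G]

namespace Block

/-- The matrix of the action of `h` on `V_{𝒞,π}`. -/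
def repMatrix (X : Block k G) (h : G) : Matrix X.Idx X.Idx k :=
  fun x y => if x.1 = X.conj h y.1 then X.π (X.ζ y.1 h) x.2 y.2 else 0

theorem repMatrix_one (X : Block k G) : X.repMatrix 1 = 1 := by
  ext x y
  simp only [repMatrix, X.conj_one, X.ζ_one, map_one, Matrix.one_apply]
  rw [← ite_and]
  exact if_congr Prod.ext_iff.symm rfl rfl

theorem repMatrix_mul (X : Block k G) (g h : G) :
    X.repMatrix (g * h) = X.repMatrix g * X.repMatrix h := by
  ext x y
  simp only [Matrix.mul_apply, repMatrix, X.conj_mul, X.ζ_mul, map_mul, Fintype.sum_prod_type]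
  rw [Finset.sum_eq_single (X.conj h y.1)]
  · by_cases h1 : x.1 = X.conj g (X.conj h y.1) <;> simp [h1]
  · intro c _ hc
    simp [hc]
  · exact fun h => absurd (Finset.mem_univ _) h

/-- The action of `G` on `V_{𝒞,π}` in the basis `E_{ci}`. -/
def rep (X : Block k G) : G →* Matrix X.Idx X.Idx k where
  toFun := X.repMatrix
  map_one' := X.repMatrix_one
  map_mul' := X.repMatrix_mul

theorem rep_apply (X : Block k G) (h : G) (x y : X.Idx) :
    X.rep h x y = if x.1 = X.conj h y.1 then X.π (X.ζ y.1 h) x.2 y.2 else 0 := rfl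

theorem rep_eq_zero (X : Block k G) {h : G} {x y : X.Idx}
    (hxy : (x.1 : G) ≠ h * y.1 * h⁻¹) : X.rep h x y = 0 :=
  if_neg fun h1 => hxy (congrArg Subtype.val h1)

theorem ζ_inv (X : Block k G) (c : X.Class) (h : G) :
    (X.ζ c h)⁻¹ = X.ζ (X.conj h c) h⁻¹ := by
  rw [inv_eq_iff_mul_eq_one, mul_eq_one_iff_eq_inv, eq_comm, inv_eq_iff_mul_eq_one, ← X.ζ_mul,
    inv_mul_cancel, X.ζ_one]

/-- Column y of the matrix of h is supported on the single class element h|y|h⁻¹. This links sums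
over all labels to the formulas in terms of `π` and `ζ`. -/
theorem sum_rep_smul {M : Type*} [AddCommMonoid M] [Module k M] (X : Block k G) (h : G)
    (y : X.Idx) (F : X.Idx → M) :
    ∑ x, X.rep h x y • F x =
      ∑ m : Fin X.dim, X.π (X.ζ y.1 h) m y.2 • F (X.conj h y.1, m) := by
  rw [Fintype.sum_prod_type, Finset.sum_eq_single (X.conj h y.1)]
  · simp [rep_apply]
  · intro c _ hc
    simp [rep_apply, hc]
  · exact fun h => absurd (Finset.mem_univ _) h

theorem sum_rep_inv_smul {M : Type*} [AddCommMonoid M] [Module k M] (X : Block k G) (h : G)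
    (y : X.Idx) (F : X.Idx → M) :
    ∑ x, X.rep h⁻¹ y x • F x =
      ∑ m : Fin X.dim, X.π (X.ζ y.1 h)⁻¹ y.2 m • F (X.conj h y.1, m) := by
  have h1 : ∀ c : X.Class, y.1 = X.conj h⁻¹ c ↔ c = X.conj h y.1 := fun c => by
    constructor
    · intro h1; rw [h1, ← X.conj_mul, mul_inv_cancel, X.conj_one]
    · intro h1; rw [h1, ← X.conj_mul, inv_mul_cancel, X.conj_one]
  rw [Fintype.sum_prod_type, Finset.sum_eq_single (X.conj h y.1)]
  · simp [rep_apply, h1, X.ζ_inv]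
  · intro c _ hc
    simp [rep_apply, h1, hc]
  · exact fun h => absurd (Finset.mem_univ _) h

end Block

/-! ### The R-matrix, its inverses and the Yang–Baxter equation -/

section RMatrix

theorem coquasi_single (x y : G × G) (a b : k) :
    coquasi k G (Finsupp.single x a) (Finsupp.single y b) =
      if x.1 = 1 ∧ x.2 = y.1 then a * b else 0 := by
  simp only [coquasi, Finsupp.linearCombination_single, LinearMap.smul_apply, smul_eq_mul]
  split_ifs <;> simp

open Classical in
theorem rMatrix_eq_sum (X : σ → Block k G) (s t : σ) (a b : (X s).Idx) (c d : (X t).Idx) :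
    rMatrix X s t a b c d = ∑ n : Subgroup.centralizer ({(X s).r} : Set G),
      ∑ m : Subgroup.centralizer ({(X t).r} : Set G),
        if (X s).q a.1 * n * ((X s).q b.1)⁻¹ = 1 ∧ (b.1 : G) = (X t).q c.1 * m * ((X t).q d.1)⁻¹
        then (X s).π n a.2 b.2 * (X t).π m c.2 d.2 else 0 := by
  rw [rMatrix, Block.coeff, Block.coeff]
  simp only [map_sum, LinearMap.sum_apply, coquasi_single]
  rw [Finset.sum_comm]

/-- The condition q_a n q_b⁻¹ = e gives q_b = q_a n with n centralising the base point, hence |a| =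
|b| and n = e. The other condition forces m = q_c⁻¹ |b| q_d; this lies in the centraliser only if
|c| = |b||d||b|⁻¹, and then it is ζ_d(|b|). -/
theorem rMatrix_eq (X : σ → Block k G) (s t : σ) (a b : (X s).Idx) (c d : (X t).Idx) :
    rMatrix X s t a b c d = if a = b then (X t).rep a.1 c d else 0 := by
  classical
  rw [rMatrix_eq_sum]
  by_cases hab : a.1 = b.1
  · rw [Finset.sum_eq_single 1]
    · simp only [hab, OneMemClass.coe_one, mul_one, mul_inv_cancel, true_and, map_one,
        Matrix.one_apply]
      have h1 : a = b ↔ a.2 = b.2 := by rw [Prod.ext_iff]; simp [hab]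
      rw [Block.rep_apply]
      by_cases h2 : c.1 = (X t).conj (b.1 : G) d.1
      · rw [Finset.sum_eq_single ((X t).ζ d.1 b.1), if_pos, if_pos h2]
        · simp [h1]
        · simp [Block.ζ, ← h2, mul_assoc]
        · intro m _ hm
          refine if_neg fun h3 => hm (Subtype.ext ?_)
          simp only [Block.ζ, ← h2]
          rw [h3]; group
        · exact fun h => absurd (Finset.mem_univ _) h
      · rw [if_neg h2, ite_self]
        refine Finset.sum_eq_zero fun m _ => if_neg fun h3 => h2 (Subtype.ext ?_)
        simp only [Block.conj]
        have hm := Subgroup.mem_centralizer_singleton_iff.1 m.2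
        rw [h3, ← (X t).q_conj c.1, ← (X t).q_conj d.1]
        generalize (X t).q c.1 = u
        generalize (X t).q d.1 = v
        have h5 : m * (X t).r * (m : G)⁻¹ = (X t).r := by rw [hm, mul_inv_cancel_right]
        generalize (m : G) = m' at *
        conv_lhs => rw [← h5]
        group
    · intro n _ hn
      refine Finset.sum_eq_zero fun m _ => if_neg fun h3 => hn (Subtype.ext ?_)
      have h4 := h3.1
      rw [hab, mul_inv_eq_one, mul_eq_left] at h4
      exact h4
    · exact fun h => absurd (Finset.mem_univ _) h
  · rw [if_neg (fun h => hab (congrArg Prod.fst h))]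
    refine Finset.sum_eq_zero fun n _ => Finset.sum_eq_zero fun m _ => if_neg fun h3 => hab ?_
    have hn := Subgroup.mem_centralizer_singleton_iff.1 n.2
    have h4 := h3.1
    rw [mul_inv_eq_one] at h4
    refine Subtype.ext ?_
    rw [← (X s).q_conj b.1, ← (X s).q_conj a.1, ← h4]
    have h5 : (X s).r = n * (X s).r * (n : G)⁻¹ := by rw [hn, mul_inv_cancel_right]
    generalize (n : G) = n' at *
    conv_lhs => rw [h5]
    group

theorem rMatrix_eq' (X : σ → Block k G) (s t : σ) (a b : (X s).Idx) (c d : (X t).Idx) :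
    rMatrix X s t a b c d =
      if a = b ∧ (c.1 : G) = (a.1 : G) * d.1 * (a.1 : G)⁻¹ then
        (X t).π ((X t).ζ d.1 a.1) c.2 d.2 else 0 := by
  rw [rMatrix_eq, ite_and, Block.rep_apply]
  simp only [Subtype.ext_iff, Block.conj]

variable (X : σ → Block k G) (s t : σ)

/-- The matrix is block diagonal in the first label with blocks ρ(|x|), so it is inverted block by
block. -/
theorem flat_mul_inv :
    flat (rMatrix X) s t * Matrix.of (fun x y => if x.1 = y.1 then (X t).rep (x.1.1 : G)⁻¹ x.2 y.2 else 0) =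
      1 := by
  ext x y
  rw [Matrix.mul_apply, Fintype.sum_prod_type]
  simp only [flat, rMatrix_eq, Matrix.of_apply]
  rw [Finset.sum_eq_single x.1]
  · by_cases h : x.1 = y.1
    · simp only [h, if_true]
      rw [← Matrix.mul_apply, ← map_mul, mul_inv_cancel, map_one, Matrix.one_apply,
        Matrix.one_apply]
      exact if_congr (by rw [Prod.ext_iff (x := x)]; simp [h]) rfl rfl
    · simp only [if_neg h, mul_zero, Finset.sum_const_zero]
      rw [Matrix.one_apply, if_neg (fun h1 => h (congrArg Prod.fst h1))]
  · intro c _ hc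
    simp [hc.symm]
  · exact fun h => absurd (Finset.mem_univ _) h

/-- Exchanging the indices of the second factor transposes each block ρ(|x|), so the blocks of the
inverse are the transposes of ρ(|x|⁻¹). Hence the second inverse has the same entries as the
inverse. -/
theorem flatHat_mul_inv :
    flatHat (rMatrix X) s t *
      Matrix.of (fun x y => if x.1 = y.1 then (X t).rep (x.1.1 : G)⁻¹ y.2 x.2 else 0) = 1 := by
  ext x y
  rw [Matrix.mul_apply, Fintype.sum_prod_type]
  simp only [flatHat, rMatrix_eq, Matrix.of_apply]
  rw [Finset.sum_eq_single x.1]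
  · by_cases h : x.1 = y.1
    · simp only [h, if_true]
      simp only [mul_comm ((X t).rep (y.1.1 : G) _ _)]
      rw [← Matrix.mul_apply, ← map_mul, inv_mul_cancel, map_one, Matrix.one_apply,
        Matrix.one_apply]
      exact if_congr (by rw [eq_comm, Prod.ext_iff (x := x)]; simp [h]) rfl rfl
    · simp only [if_neg h, mul_zero, Finset.sum_const_zero]
      rw [Matrix.one_apply, if_neg (fun h1 => h (congrArg Prod.fst h1))]
  · intro c _ hc
    simp [hc.symm]
  · exact fun h => absurd (Finset.mem_univ _) h

theorem rInv_rMatrix (a b : (X s).Idx) (c d : (X t).Idx) :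
    rInv (rMatrix X) s t a b c d = if a = b then (X t).rep (a.1 : G)⁻¹ c d else 0 := by
  rw [rInv, Matrix.inv_eq_right_inv (flat_mul_inv X s t)]
  rfl

theorem rHat_rMatrix (a b : (X s).Idx) (c d : (X t).Idx) :
    rHat (rMatrix X) s t a b c d = if a = b then (X t).rep (a.1 : G)⁻¹ c d else 0 := by
  rw [rHat, Matrix.inv_eq_right_inv (flatHat_mul_inv X s t)]
  rfl

theorem isBiinvertible_rMatrix : IsBiinvertible (rMatrix X) where
  yang_baxter s t u i l j m h n := by
    simp only [rMatrix_eq]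
    have e1 : ∀ a b c, (if i = a then (X t).rep (i.1 : G) j b else 0) *
        (if a = l then (X u).rep (a.1 : G) h c else 0) *
        (if b = m then (X u).rep (b.1 : G) c n else 0) =
        if i = a then (if b = m then (if i = l then (X t).rep (i.1 : G) j m *
          ((X u).rep (i.1 : G) h c * (X u).rep (m.1 : G) c n) else 0) else 0) else 0 := by
      intro a b c
      by_cases h1 : i = a
      · subst h1
        by_cases h2 : b = m
        · subst h2; split_ifs <;> simp [mul_assoc]
        · simp [h2]
      · simp [h1]
    have e2 : ∀ a b c, (if j = b then (X u).rep (j.1 : G) h c else 0) *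
        (if i = a then (X u).rep (i.1 : G) c n else 0) *
        (if a = l then (X t).rep (a.1 : G) b m else 0) =
        if i = a then (if j = b then (if i = l then (X t).rep (i.1 : G) j m *
          ((X u).rep (j.1 : G) h c * (X u).rep (i.1 : G) c n) else 0) else 0) else 0 := by
      intro a b c
      by_cases h1 : i = a
      · subst h1
        by_cases h2 : j = b
        · subst h2; split_ifs <;> ring
        · simp [h2]
      · simp [h1]
    simp only [e1, e2]
    have e3 : ∀ F : (X u).Idx → k, (∑ a, ∑ b, ∑ c, if i = a then (if b = m then F c else 0) else 0)
        = ∑ c, F c := fun F => by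
      rw [Finset.sum_eq_single i (by intro a _ ha; simp [ha.symm]) (by simp),
        Finset.sum_eq_single m (by intro a _ ha; simp [ha]) (by simp)]
      simp
    have e4 : ∀ F : (X u).Idx → k, (∑ a, ∑ b, ∑ c, if i = a then (if j = b then F c else 0) else 0)
        = ∑ c, F c := fun F => by
      rw [Finset.sum_eq_single i (by intro a _ ha; simp [ha.symm]) (by simp),
        Finset.sum_eq_single j (by intro a _ ha; simp [ha.symm]) (by simp)]
      simp
    rw [e3, e4]
    split_ifs with h1
    swap
    · rfl
    rw [← Finset.mul_sum, ← Finset.mul_sum, ← Matrix.mul_apply, ← Matrix.mul_apply, ← map_mul,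
      ← map_mul]
    -- Both sides contain the factor ρ(|i|)^j_m. Where it does not vanish, |j||i| = |i||m|, so the
    -- remaining factors, entries of ρ(|i||m|) and ρ(|j||i|), agree.
    by_cases h2 : (j.1 : G) = i.1 * m.1 * (i.1 : G)⁻¹
    · rw [h2]; simp [mul_assoc]
    · rw [(X t).rep_eq_zero h2]; simp
  isUnit s t := IsUnit.of_mul_eq_one _ (flat_mul_inv X s t)
  isUnit_hat s t := IsUnit.of_mul_eq_one _ (flatHat_mul_inv X s t)

end RMatrix

end BlockRep

/-! ### Separate actions on the lower and upper indices of matrix units -/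

section LieOperators

variable {k G σ : Type*} [Field k] [Group G] [Fintype G] [DecidableEq G]
variable (X : σ → Block k G)

/-- The action of `h` on the lower index of the matrix units. -/
noncomputable def lowerAct (h : G) : Module.End k (LieSpace X) :=
  Finsupp.linearCombination k fun z : Gen (fun s => (X s).Idx) =>
    ∑ m, (X z.1).rep h m z.2.1 • E X z.1 m z.2.2

/-- The contragredient action of `h` on the upper index of the matrix units. -/
noncomputable def upperAct (h : G) : Module.End k (LieSpace X) :=
  Finsupp.linearCombination k fun z : Gen (fun s => (X s).Idx) =>
    ∑ l, (X z.1).rep h⁻¹ z.2.2 l • E X z.1 z.2.1 l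

/-- The projection to the span of the `E_{ai}^{bj}` with given `b`. -/
noncomputable def upperProj (b : G) : Module.End k (LieSpace X) :=
  Finsupp.linearCombination k fun z : Gen (fun s => (X s).Idx) =>
    if (z.2.2.1 : G) = b then E X z.1 z.2.1 z.2.2 else 0

theorem lowerAct_E (h : G) (s : σ) (x y : (X s).Idx) :
    lowerAct X h (E X s x y) = ∑ m, (X s).rep h m x • E X s m y := by
  simp [lowerAct, E]

theorem upperAct_E (h : G) (s : σ) (x y : (X s).Idx) :
    upperAct X h (E X s x y) = ∑ l, (X s).rep h⁻¹ y l • E X s x l := by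
  simp [upperAct, E]

theorem upperProj_E (b : G) (s : σ) (x y : (X s).Idx) :
    upperProj X b (E X s x y) = if (y.1 : G) = b then E X s x y else 0 := by
  simp [upperProj, E]

variable {X}

theorem lieSpace_hom_ext {M : Type*} [AddCommMonoid M] [Module k M] {f g : LieSpace X →ₗ[k] M}
    (h : ∀ s (x y : (X s).Idx), f (E X s x y) = g (E X s x y)) : f = g := by
  refine Finsupp.lhom_ext' fun z => LinearMap.ext_ring ?_
  obtain ⟨s, x, y⟩ := z
  exact h s x y

/-- The lower action keeps the upper label, so an identity valid for all lower labels may be shifted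
by it. This is how group elements are moved from one side of a relation to the other. -/
theorem map_lowerAct_congr {M : Type*} [AddCommMonoid M] [Module k M]
    (F F' : LieSpace X →ₗ[k] M) {s : σ} {y : (X s).Idx}
    (h : ∀ x, F (E X s x y) = F' (E X s x y)) (g : G) (x : (X s).Idx) :
    F (lowerAct X g (E X s x y)) = F' (lowerAct X g (E X s x y)) := by
  simp only [lowerAct_E, map_sum, map_smul, h]

theorem lowerAct_one (v : LieSpace X) : lowerAct X 1 v = v := by
  refine LinearMap.congr_fun (g := LinearMap.id) (lieSpace_hom_ext fun s x y => ?_) v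
  rw [lowerAct_E, map_one]
  simp [Matrix.one_apply]

theorem lowerAct_mul (g h : G) (v : LieSpace X) :
    lowerAct X g (lowerAct X h v) = lowerAct X (g * h) v := by
  refine LinearMap.congr_fun (f := lowerAct X g ∘ₗ lowerAct X h) (lieSpace_hom_ext fun s x y => ?_) v
  simp only [LinearMap.comp_apply, lowerAct_E, map_sum, map_smul, map_mul, Matrix.mul_apply,
    Finset.smul_sum, Finset.sum_smul, smul_smul]
  rw [Finset.sum_comm]
  simp only [mul_comm]

theorem upperAct_one (v : LieSpace X) : upperAct X 1 v = v := by
  refine LinearMap.congr_fun (g := LinearMap.id) (lieSpace_hom_ext fun s x y => ?_) v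
  rw [upperAct_E, inv_one, map_one]
  simp [Matrix.one_apply]

theorem upperAct_mul (g h : G) (v : LieSpace X) :
    upperAct X g (upperAct X h v) = upperAct X (g * h) v := by
  refine LinearMap.congr_fun (f := upperAct X g ∘ₗ upperAct X h) (lieSpace_hom_ext fun s x y => ?_) v
  simp only [LinearMap.comp_apply, upperAct_E, map_sum, map_smul, mul_inv_rev, map_mul,
    Matrix.mul_apply, Finset.smul_sum, Finset.sum_smul, smul_smul]
  rw [Finset.sum_comm]

theorem lowerAct_upperAct (g h : G) (v : LieSpace X) :
    lowerAct X g (upperAct X h v) = upperAct X h (lowerAct X g v) := by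
  refine LinearMap.congr_fun (f := lowerAct X g ∘ₗ upperAct X h) (g := upperAct X h ∘ₗ lowerAct X g)
    (lieSpace_hom_ext fun s x y => ?_) v
  simp only [LinearMap.comp_apply, upperAct_E, lowerAct_E, map_sum, map_smul, Finset.smul_sum,
    smul_smul]
  rw [Finset.sum_comm]
  simp only [mul_comm]

/-- This is End V = V ⊗ V*. The split is needed because the relations of both algebras move one
factor by the lower half of the action alone. -/
theorem lieAct_eq (h : G) (v : LieSpace X) : lieAct X h v = lowerAct X h (upperAct X h v) := by
  refine LinearMap.congr_fun (g := lowerAct X h ∘ₗ upperAct X h) (lieSpace_hom_ext fun s x y => ?_) v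
  rw [LinearMap.comp_apply, lieAct_E, upperAct_E, Block.sum_rep_inv_smul, map_sum, Finset.sum_comm]
  refine Finset.sum_congr rfl fun l _ => ?_
  rw [map_smul, lowerAct_E, Block.sum_rep_smul, Finset.smul_sum]
  simp only [smul_smul, mul_comm]

theorem upperProj_lowerAct (b h : G) (v : LieSpace X) :
    upperProj X b (lowerAct X h v) = lowerAct X h (upperProj X b v) := by
  refine LinearMap.congr_fun (f := upperProj X b ∘ₗ lowerAct X h)
    (g := lowerAct X h ∘ₗ upperProj X b) (lieSpace_hom_ext fun s x y => ?_) v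
  simp only [LinearMap.comp_apply, upperProj_E, lowerAct_E, map_sum, map_smul]
  split_ifs with h1
  · rw [lowerAct_E]
  · simp

theorem upperProj_upperAct (b h : G) (v : LieSpace X) :
    upperProj X (h * b * h⁻¹) (upperAct X h v) = upperAct X h (upperProj X b v) := by
  refine LinearMap.congr_fun (f := upperProj X (h * b * h⁻¹) ∘ₗ upperAct X h)
    (g := upperAct X h ∘ₗ upperProj X b) (lieSpace_hom_ext fun s x y => ?_) v
  simp only [LinearMap.comp_apply, upperProj_E, upperAct_E, map_sum, map_smul]
  -- A nonzero entry of ρ(h⁻¹) in row y and column l forces |l| = h|y|h⁻¹, so the upper action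
  -- carries upper grade b to hbh⁻¹.
  have h2 : ∀ l : (X s).Idx, (X s).rep h⁻¹ y l ≠ 0 → ((l.1 : G) = h * b * h⁻¹ ↔ (y.1 : G) = b) := by
    intro l hl
    have h3 : (y.1 : G) = h⁻¹ * l.1 * h⁻¹⁻¹ := by
      by_contra h3; exact hl ((X s).rep_eq_zero h3)
    rw [h3, inv_inv]
    constructor
    · intro h4; rw [h4]; group
    · intro h4; rw [← h4]; group
  have h3 : ∀ l : (X s).Idx, (X s).rep h⁻¹ y l •
      (if (l.1 : G) = h * b * h⁻¹ then E X s x l else 0) =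
      if (y.1 : G) = b then (X s).rep h⁻¹ y l • E X s x l else 0 := by
    intro l
    by_cases hl : (X s).rep h⁻¹ y l = 0
    · simp [hl]
    · simp only [h2 l hl]; split_ifs <;> simp
  simp only [h3]
  split_ifs with h1
  · rw [upperAct_E]
  · simp

theorem upperProj_lieAct (b h : G) (v : LieSpace X) :
    upperProj X (h * b * h⁻¹) (lieAct X h v) = lieAct X h (upperProj X b v) := by
  rw [lieAct_eq, lieAct_eq, upperProj_lowerAct, upperProj_upperAct]

theorem lieComul_E (s : σ) (x y : (X s).Idx) :
    lieComul X (E X s x y) = ∑ w, E X s x w ⊗ₜ[k] E X s w y := by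
  simp [lieComul, E]

theorem lieCounit_E (s : σ) (x y : (X s).Idx) :
    lieCounit X (E X s x y) = if x = y then 1 else 0 := by
  simp [lieCounit, E]

/-- Acting on the contracted indices of the coproduct does not change it. -/
theorem upperAct_lowerAct_comul (h : G) (v : LieSpace X) :
    TensorProduct.map (upperAct X h) (lowerAct X h) (lieComul X v) = lieComul X v := by
  refine LinearMap.congr_fun (f := TensorProduct.map (upperAct X h) (lowerAct X h) ∘ₗ lieComul X)
    (lieSpace_hom_ext fun s x y => ?_) v
  simp only [LinearMap.comp_apply, lieComul_E, map_sum, TensorProduct.map_tmul, upperAct_E,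
    lowerAct_E, TensorProduct.sum_tmul, TensorProduct.tmul_sum, TensorProduct.smul_tmul_smul]
  rw [Finset.sum_comm]
  -- The matrices from the two contracted indices multiply to ρ(h)ρ(h⁻¹) = 1.
  have : ∀ a b : (X s).Idx, ∑ z, ((X s).rep h⁻¹ z a * (X s).rep h b z) = if b = a then 1 else 0 := by
    intro a b
    simp only [mul_comm ((X s).rep h⁻¹ _ _)]
    rw [← Matrix.mul_apply, ← map_mul, mul_inv_cancel, map_one, Matrix.one_apply]
  refine Finset.sum_congr rfl fun a _ => ?_
  rw [Finset.sum_comm]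
  simp only [← Finset.sum_smul, this]
  simp

theorem isHomog_E (s : σ) (x y : (X s).Idx) :
    (lieCrossed X).IsHomog ((x.1 : G) * (y.1 : G)⁻¹) (E X s x y) := by
  change lieProj X _ _ = _
  rw [lieProj_E, if_pos rfl]

theorem isHomog_lowerAct_E (h : G) (s : σ) (x y : (X s).Idx) :
    (lieCrossed X).IsHomog (h * x.1 * h⁻¹ * (y.1 : G)⁻¹) (lowerAct X h (E X s x y)) := by
  change lieProj X _ _ = _
  rw [lowerAct_E, map_sum]
  refine Finset.sum_congr rfl fun m _ => ?_
  rw [map_smul, lieProj_E]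
  by_cases h1 : (m.1 : G) = h * x.1 * h⁻¹
  · rw [h1, if_pos rfl]
  · rw [(X s).rep_eq_zero h1, zero_smul, zero_smul]

end LieOperators

/-! ### The relations of the enveloping algebra -/

section Relations

variable {k G σ : Type*} [Field k] [Group G] [Fintype G] [DecidableEq G] {X : σ → Block k G}
  {B : Type*} [Ring B] [Algebra k B]

/-- The relations `y x = (|y| ▷ x) (b ▷ y)` for `x = E_{ai}^{bj}` and `y` homogeneous, where `|y|`
acts on the lower index of `x`. -/
def LieRel (g : LieSpace X →ₗ[k] B) : Prop :=
  ∀ (s : σ) (i j : (X s).Idx) (c : G) (y : LieSpace X), (lieCrossed X).IsHomog c y →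
    g y * g (E X s i j) = g (lowerAct X c (E X s i j)) * g (lieAct X j.1 y)

/-- The label j enters the relation only through E_i^j and |j|, so linear combinations with a common
upper grade are allowed. -/
theorem LieRel.of_upper {g : LieSpace X →ₗ[k] B} (hg : LieRel g) {b c : G} {x y : LieSpace X}
    (hx : upperProj X b x = x) (hy : (lieCrossed X).IsHomog c y) :
    g y * g x = g (lowerAct X c x) * g (lieAct X b y) := by
  rw [← hx]
  refine LinearMap.congr_fun (f := LinearMap.mulLeft k (g y) ∘ₗ g ∘ₗ upperProj X b)
    (g := LinearMap.mulRight k (g (lieAct X b y)) ∘ₗ g ∘ₗ lowerAct X c ∘ₗ upperProj X b)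
    (lieSpace_hom_ext fun s i j => ?_) x
  simp only [LinearMap.comp_apply, upperProj_E, LinearMap.mulLeft_apply, LinearMap.mulRight_apply]
  split_ifs with h
  · rw [← h]; exact hg s i j c y hy
  · simp

/-- For fixed c both sides are linear in the component of y of grade c, which is spanned by the
matrix units E_a^l with |a||l|⁻¹ = c. -/
theorem LieRel.of_basis {g : LieSpace X →ₗ[k] B}
    (hg : ∀ (s t : σ) (i j : (X s).Idx) (a l : (X t).Idx), g (E X t a l) * g (E X s i j) =
      g (lowerAct X ((a.1 : G) * (l.1 : G)⁻¹) (E X s i j)) * g (lieAct X j.1 (E X t a l))) :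
    LieRel g := by
  intro s i j c y hy
  rw [← hy]
  refine LinearMap.congr_fun (f := LinearMap.mulRight k (g (E X s i j)) ∘ₗ g ∘ₗ lieProj X c)
    (g := LinearMap.mulLeft k (g (lowerAct X c (E X s i j))) ∘ₗ g ∘ₗ lieAct X j.1 ∘ₗ lieProj X c)
    (lieSpace_hom_ext fun t a l => ?_) y
  simp only [LinearMap.comp_apply, lieProj_E, LinearMap.mulLeft_apply, LinearMap.mulRight_apply]
  split_ifs with h
  · rw [← h]; exact hg s t i j a l
  · simp

theorem lieAct_lieAct (g h : G) (y : LieSpace X) : lieAct X g (lieAct X h y) = lieAct X (g * h) y :=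
  GCrossedModule.act_act (M := lieCrossed X) g h y

theorem isHomog_lieAct {c : G} {y : LieSpace X} (hy : (lieCrossed X).IsHomog c y) (h : G) :
    (lieCrossed X).IsHomog (h * c * h⁻¹) (lieAct X h y) := hy.act h

/-- The left side is the delta condition of the bracket, the right side the support condition for
the entry in row j and column i of ρ(w⁻¹), with w = j⁻¹cj. So the bracket has plain entries of ρ as
coefficients, without a separate delta. -/
theorem mul_mul_inv_eq_conj_iff (i j c : G) : i * j⁻¹ * c = j⁻¹ * c * j ↔
    j = (j⁻¹ * c * j)⁻¹ * i * (j⁻¹ * c * j)⁻¹⁻¹ := by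
  generalize hw : j⁻¹ * c * j = w
  have hc : c = j * w * j⁻¹ := by rw [← hw]; group
  rw [hc]
  constructor
  · intro h
    calc j = (i * j⁻¹ * (j * w * j⁻¹))⁻¹ * i * w := by group
      _ = _ := by rw [h, inv_inv]
  · intro h
    calc i * j⁻¹ * (j * w * j⁻¹) = i * w * j⁻¹ := by group
      _ = i * w * (w⁻¹ * i * w⁻¹⁻¹)⁻¹ := by rw [← h]
      _ = w := by group

theorem lieBracket_E (s : σ) (i j : (X s).Idx) {c : G} {y : LieSpace X}
    (hy : (lieCrossed X).IsHomog c y) :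
    lieBracket X (E X s i j ⊗ₜ y) =
      (X s).rep ((j.1 : G)⁻¹ * c * j.1)⁻¹ j i • lieAct X (j.1 : G)⁻¹ y := by
  rw [← hy]
  refine LinearMap.congr_fun (f := lieBracket X ∘ₗ TensorProduct.mk k _ _ (E X s i j) ∘ₗ lieProj X c)
    (g := (X s).rep ((j.1 : G)⁻¹ * c * j.1)⁻¹ j i • (lieAct X (j.1 : G)⁻¹ ∘ₗ lieProj X c))
    (lieSpace_hom_ext fun t a l => ?_) y
  simp only [LinearMap.comp_apply, LinearMap.smul_apply, lieProj_E]
  split_ifs with h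
  swap
  · simp
  subst h
  simp only [lieBracket, E, TensorProduct.mk_apply, TensorProduct.lift.tmul,
    Finsupp.linearCombination_single, one_smul, grade, Block.rep_apply,
    Subtype.ext_iff, Block.conj]
  simp only [mul_mul_inv_eq_conj_iff]
  split_ifs <;> simp

/-- For the contracted label z, the braiding acts on y by |z||j|⁻¹ and the bracket by |z|⁻¹. Thus
|z| cancels both from the action and from the conjugated grade, and the sum over z assembles a lower
action. -/
theorem lieBraiding_E (s : σ) (i j : (X s).Idx) {c : G} {y : LieSpace X}
    (hy : (lieCrossed X).IsHomog c y) :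
    lieBraiding X (E X s i j ⊗ₜ y) =
      lieAct X (j.1 : G)⁻¹ y ⊗ₜ lowerAct X ((j.1 : G)⁻¹ * c * j.1)⁻¹ (E X s i j) := by
  simp only [lieBraiding, fundamentalBraiding, LinearMap.comp_apply, comul12,
    LinearMap.rTensor_tmul, lieComul_E, TensorProduct.sum_tmul, map_sum, leg23, mul12,
    LinearEquiv.coe_coe, TensorProduct.assoc_tmul, LinearMap.lTensor_tmul,
    GCrossedModule.braiding_tmul (isHomog_E s _ _), TensorProduct.assoc_symm_tmul]
  rw [lowerAct_E, TensorProduct.tmul_sum]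
  refine Finset.sum_congr rfl fun z _ => ?_
  rw [lieBracket_E s i z (hy.act _)]
  have h1 : lieAct X (z.1 : G)⁻¹ ((lieCrossed X).act ((z.1 : G) * (j.1 : G)⁻¹) y) =
      lieAct X (j.1 : G)⁻¹ y := by
    change (lieCrossed X).act _ _ = (lieCrossed X).act _ _
    rw [GCrossedModule.act_act]; group
  rw [h1, TensorProduct.smul_tmul]
  congr 4
  group

/-- In one direction, the relation for |j|⁻¹ ▷ y undoes both operators in the braiding. In the
other, invariance on E_z^j ⊗ (|j| ▷ y) is the relation with c⁻¹ on the lower index, to be shifted by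
c. -/
theorem lieRel_iff_lieBraiding {g : LieSpace X →ₗ[k] B} :
    LieRel g ↔ ∀ x, LinearMap.mul' k B (TensorProduct.map g g (lieBraiding X x)) =
      LinearMap.mul' k B (TensorProduct.map g g x) := by
  constructor
  · intro hg x
    refine LinearMap.congr_fun (f := LinearMap.mul' k B ∘ₗ TensorProduct.map g g ∘ₗ lieBraiding X)
      (g := LinearMap.mul' k B ∘ₗ TensorProduct.map g g) ?_ x
    refine TensorProduct.ext (lieSpace_hom_ext fun s i j => (lieCrossed X).hom_ext fun c y hy => ?_)
    simp only [LinearMap.compr₂ₛₗ_apply, TensorProduct.mk_apply, LinearMap.comp_apply,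
      lieBraiding_E s i j hy, TensorProduct.map_tmul, LinearMap.mul'_apply]
    have h1 := fun z => hg s z j _ _ (isHomog_lieAct hy (j.1 : G)⁻¹)
    have h2 := map_lowerAct_congr
      (LinearMap.mulLeft k (g (lieAct X (j.1 : G)⁻¹ y)) ∘ₗ g)
      (LinearMap.mulRight k (g (lieAct X j.1 (lieAct X (j.1 : G)⁻¹ y))) ∘ₗ g ∘ₗ
        lowerAct X ((j.1 : G)⁻¹ * c * (j.1 : G)⁻¹⁻¹)) h1 ((j.1 : G)⁻¹ * c * j.1)⁻¹ i
    rw [show ((j.1 : G)⁻¹ * c * (j.1 : G)⁻¹⁻¹) = (j.1 : G)⁻¹ * c * j.1 by rw [inv_inv]] at h2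
    simpa only [LinearMap.comp_apply, LinearMap.mulLeft_apply, LinearMap.mulRight_apply,
      lowerAct_mul, mul_inv_cancel, lowerAct_one, lieAct_lieAct, lieAct_one,
      Module.End.one_apply] using h2
  · intro hg s i j c y hy
    have h1 : ∀ z, g y * g (lowerAct X c⁻¹ (E X s z j)) = g (E X s z j) * g (lieAct X j.1 y) := by
      intro z
      have h2 := hg (E X s z j ⊗ₜ lieAct X j.1 y)
      rw [lieBraiding_E s z j (isHomog_lieAct hy j.1)] at h2
      simp only [TensorProduct.map_tmul, LinearMap.mul'_apply] at h2
      rw [← h2, lieAct_lieAct, inv_mul_cancel, lieAct_one, Module.End.one_apply]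
      congr 4
      group
    have h2 := map_lowerAct_congr (LinearMap.mulLeft k (g y) ∘ₗ g ∘ₗ lowerAct X c⁻¹)
      (LinearMap.mulRight k (g (lieAct X j.1 y)) ∘ₗ g) h1 c i
    simpa only [LinearMap.comp_apply, LinearMap.mulLeft_apply, LinearMap.mulRight_apply,
      lowerAct_mul, inv_mul_cancel, lowerAct_one] using h2

end Relations

/-! ### The relations of braided matrices and the algebra isomorphism -/

section Isomorphism

variable {k G σ : Type*} [Field k] [Group G] [Fintype G] [DecidableEq G] {X : σ → Block k G}
  {B : Type*} [Ring B] [Algebra k B]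

theorem sum_rMatrix_left (g : LieSpace X →ₗ[k] B) (s t : σ) (a l : (X s).Idx) (b x : (X t).Idx) :
    (∑ y : (X s).Idx, ∑ i : (X t).Idx, ∑ j : (X t).Idx, ∑ m : (X s).Idx,
      (rMatrix X s t y a i b * rMatrix X t s x j m y) • (g (E X t i j) * g (E X s m l))) =
    g (lowerAct X a.1 (E X t b x)) * g (lowerAct X x.1 (E X s a l)) := by
  simp only [rMatrix_eq]
  rw [Finset.sum_eq_single a (fun y _ hy => by simp [hy]) (by simp)]
  simp only [lowerAct_E, map_sum, map_smul, Finset.sum_mul_sum, smul_mul_smul_comm]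
  refine Finset.sum_congr rfl fun i _ => ?_
  rw [Finset.sum_eq_single x (fun y _ hy => by simp [hy.symm]) (by simp)]
  simp

/-- Unlike on the other side of the relations, the sum over r survives the deltas: r is contracted
with an upper index and its class element |r| also acts on the second generator. -/
theorem sum_rMatrix_right (g : LieSpace X →ₗ[k] B) (s t : σ) (a l : (X s).Idx)
    (b x : (X t).Idx) :
    (∑ n : (X s).Idx, ∑ r : (X s).Idx, ∑ p : (X t).Idx, ∑ q : (X t).Idx,
      (rMatrix X s t r n p b * rMatrix X t s x q l r) • (g (E X s a n) * g (E X t p q))) =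
    ∑ r : (X s).Idx, (X s).rep x.1 l r • (g (E X s a r) * g (lowerAct X r.1 (E X t b x))) := by
  simp only [rMatrix_eq]
  refine Finset.sum_congr rfl fun n _ => ?_
  rw [Finset.sum_eq_single n (fun y _ hy => by simp [hy]) (by simp)]
  simp only [lowerAct_E, map_sum, map_smul, Finset.mul_sum, Finset.smul_sum, mul_smul_comm,
    smul_smul]
  refine Finset.sum_congr rfl fun p _ => ?_
  rw [Finset.sum_eq_single x (fun y _ hy => by simp [hy.symm]) (by simp)]
  simp [mul_comm]

/-- The relations of `B(𝓡)` in terms of the action on lower indices. -/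
def BraidedMatrixLieRel (g : LieSpace X →ₗ[k] B) : Prop :=
  ∀ (s t : σ) (a l : (X s).Idx) (b x : (X t).Idx),
    g (lowerAct X a.1 (E X t b x)) * g (lowerAct X x.1 (E X s a l)) =
      ∑ r : (X s).Idx, (X s).rep x.1 l r • (g (E X s a r) * g (lowerAct X r.1 (E X t b x)))

/-- The sum is the upper action of h⁻¹, which cancels the upper half of h. -/
theorem sum_rep_smul_lieAct (h : G) (s : σ) (a l : (X s).Idx) :
    lieAct X h (∑ r, (X s).rep h l r • E X s a r) = lowerAct X h (E X s a l) := by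
  have h1 : ∑ r, (X s).rep h l r • E X s a r = upperAct X h⁻¹ (E X s a l) := by
    rw [upperAct_E, inv_inv]
  rw [h1, lieAct_eq, upperAct_mul, mul_inv_cancel, upperAct_one]

theorem sum_rep_inv_smul_lowerAct (h : G) (s : σ) (a l : (X s).Idx) :
    ∑ r, (X s).rep h⁻¹ l r • lowerAct X h (E X s a r) = lieAct X h (E X s a l) := by
  rw [lieAct_eq, upperAct_E]
  simp only [map_sum, map_smul]

/-- When E_a^r is moved past the second generator, its grade |a||r|⁻¹ meets the lower action of |r|
and leaves |a|. Only |x| ▷ E_a^r then depends on r, and the sum collapses to a lower action. -/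
theorem LieRel.braidedMatrixLieRel {g : LieSpace X →ₗ[k] B} (hg : LieRel g) :
    BraidedMatrixLieRel g := by
  intro s t a l b x
  have h1 : ∀ r : (X s).Idx, g (E X s a r) * g (lowerAct X r.1 (E X t b x)) =
      g (lowerAct X a.1 (E X t b x)) * g (lieAct X x.1 (E X s a r)) := by
    intro r
    have h2 := map_lowerAct_congr (LinearMap.mulLeft k (g (E X s a r)) ∘ₗ g)
      (LinearMap.mulRight k (g (lieAct X x.1 (E X s a r))) ∘ₗ g ∘ₗ
        lowerAct X ((a.1 : G) * (r.1 : G)⁻¹))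
      (fun z => hg t z x _ _ (isHomog_E s a r)) r.1 b
    simpa only [LinearMap.comp_apply, LinearMap.mulLeft_apply, LinearMap.mulRight_apply,
      lowerAct_mul, inv_mul_cancel_right] using h2
  simp only [h1, ← mul_smul_comm, ← Finset.mul_sum, ← map_smul, ← map_sum, sum_rep_smul_lieAct]

/-- Summing the relations against ρ(|x|⁻¹) inverts the matrix ρ(|x|) on their right side and
isolates a single product; a shift by |l|⁻¹ on the lower index finishes. -/
theorem BraidedMatrixLieRel.lieRel {g : LieSpace X →ₗ[k] B} (hg : BraidedMatrixLieRel g) :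
    LieRel g := by
  refine LieRel.of_basis fun s t b x a l => ?_
  have h1 : ∀ z, g (E X t a l) * g (lowerAct X l.1 (E X s z x)) =
      g (lowerAct X a.1 (E X s z x)) * g (lieAct X x.1 (E X t a l)) := by
    intro z
    rw [← sum_rep_inv_smul_lowerAct]
    simp only [map_sum, map_smul, Finset.mul_sum, mul_smul_comm, hg t s a _ z x, Finset.smul_sum,
      smul_smul]
    rw [Finset.sum_comm]
    simp only [← Finset.sum_smul, ← Matrix.mul_apply, ← map_mul, inv_mul_cancel, map_one,
      Matrix.one_apply]
    simp
  have h2 := map_lowerAct_congr (LinearMap.mulLeft k (g (E X t a l)) ∘ₗ g ∘ₗ lowerAct X l.1)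
    (LinearMap.mulRight k (g (lieAct X x.1 (E X t a l))) ∘ₗ g ∘ₗ lowerAct X a.1) h1 (l.1 : G)⁻¹ b
  simpa only [LinearMap.comp_apply, LinearMap.mulLeft_apply, LinearMap.mulRight_apply,
    lowerAct_mul, mul_inv_cancel, lowerAct_one] using h2

theorem lieRel_iff_braidedMatrixLieRel {g : LieSpace X →ₗ[k] B} :
    LieRel g ↔ BraidedMatrixLieRel g :=
  ⟨LieRel.braidedMatrixLieRel, BraidedMatrixLieRel.lieRel⟩

theorem env_ι_apply (v : LieSpace X) :
    Env.ι (lieBraiding X) v =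
      RingQuot.mkAlgHom k (EnvRel (lieBraiding X)) (TensorAlgebra.ι k v) := rfl

theorem mkAlgHom_tensorProd {V A : Type*} [AddCommGroup V] [Module k V] [Ring A] [Algebra k A]
    (F : TensorAlgebra k V →ₐ[k] A) (x : V ⊗[k] V) :
    F (tensorProd x) = LinearMap.mul' k A (TensorProduct.map
      (F.toLinearMap ∘ₗ TensorAlgebra.ι k) (F.toLinearMap ∘ₗ TensorAlgebra.ι k) x) := by
  induction x using TensorProduct.induction_on with
  | zero => simp only [map_zero]
  | add x y hx hy => simp only [map_add, hx, hy]
  | tmul a b => simp [tensorProd]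

variable (X) in
theorem lieRel_env_ι : LieRel (Env.ι (lieBraiding X)) := by
  refine lieRel_iff_lieBraiding.2 fun x => ?_
  have h := RingQuot.mkAlgHom_rel k (EnvRel.intro (Ψt := lieBraiding X) x)
  rwa [mkAlgHom_tensorProd, mkAlgHom_tensorProd] at h

/-- The extension of a linear map satisfying the relations to the enveloping algebra. -/
noncomputable def ulLift (g : LieSpace X →ₗ[k] B) (hg : LieRel g) : UL X →ₐ[k] B :=
  RingQuot.liftAlgHom k ⟨TensorAlgebra.lift k g, by
    rintro _ _ ⟨x⟩
    have h : (TensorAlgebra.lift k g).toLinearMap ∘ₗ TensorAlgebra.ι k = g :=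
      LinearMap.ext fun v => TensorAlgebra.lift_ι_apply g v
    rw [mkAlgHom_tensorProd, mkAlgHom_tensorProd, h]
    exact lieRel_iff_lieBraiding.1 hg x⟩

theorem ulLift_ι (g : LieSpace X →ₗ[k] B) (hg : LieRel g) (v : LieSpace X) :
    ulLift g hg (Env.ι (lieBraiding X) v) = g v := by
  rw [env_ι_apply, ulLift, RingQuot.liftAlgHom_mkAlgHom_apply, TensorAlgebra.lift_ι_apply]

theorem ul_hom_ext {F F' : UL X →ₐ[k] B}
    (h : ∀ v, F (Env.ι (lieBraiding X) v) = F' (Env.ι (lieBraiding X) v)) : F = F' :=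
  RingQuot.ringQuot_ext' k _ _ (TensorAlgebra.hom_ext (LinearMap.ext h))

theorem br_ι_E (s : σ) (x y : (X s).Idx) :
    BR.ι X (E X s x y) = BraidedMatrices.u (rMatrix X) s x y := by
  simp [BR.ι, E]

/-- The algebra map from the free algebra extending a linear map of `𝓛`. -/
noncomputable def freeLift (g : LieSpace X →ₗ[k] B) :
    FreeAlgebra k (Gen fun s => (X s).Idx) →ₐ[k] B :=
  FreeAlgebra.lift k fun z => g (E X z.1 z.2.1 z.2.2)

theorem freeLift_freeGen (g : LieSpace X →ₗ[k] B) (s : σ) (x y : (X s).Idx) :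
    freeLift g (freeGen k s x y) = g (E X s x y) := by
  simp [freeLift, freeGen]

variable (X) in
theorem lieRel_br_ι : LieRel (BR.ι X) := by
  refine lieRel_iff_braidedMatrixLieRel.2 fun s t a l b x => ?_
  have h := RingQuot.mkAlgHom_rel k (BraidedMatrixRel.intro (R := rMatrix X) s t a l b x)
  simp only [map_sum, map_smul, map_mul] at h
  rw [← sum_rMatrix_left, ← sum_rMatrix_right]
  simp only [br_ι_E]
  exact h

/-- The extension of a linear map satisfying the relations to the braided matrices. -/
noncomputable def brLift (g : LieSpace X →ₗ[k] B) (hg : LieRel g) : BR X →ₐ[k] B :=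
  RingQuot.liftAlgHom k ⟨freeLift g, by
    rintro _ _ ⟨s, t, a, l, b, x⟩
    simp only [map_sum, map_smul, map_mul, freeLift_freeGen]
    rw [sum_rMatrix_left, sum_rMatrix_right]
    exact hg.braidedMatrixLieRel s t a l b x⟩

theorem brLift_ι (g : LieSpace X →ₗ[k] B) (hg : LieRel g) (v : LieSpace X) :
    brLift g hg (BR.ι X v) = g v := by
  refine LinearMap.congr_fun (f := (brLift g hg).toLinearMap ∘ₗ BR.ι X)
    (lieSpace_hom_ext fun s x y => ?_) v
  rw [LinearMap.comp_apply, br_ι_E, AlgHom.toLinearMap_apply, BraidedMatrices.u, brLift,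
    RingQuot.liftAlgHom_mkAlgHom_apply, freeLift_freeGen]

theorem br_hom_ext {F F' : BR X →ₐ[k] B} (h : ∀ v, F (BR.ι X v) = F' (BR.ι X v)) : F = F' := by
  refine RingQuot.ringQuot_ext' k _ _ (FreeAlgebra.hom_ext (funext fun z => ?_))
  have h1 := h (E X z.1 z.2.1 z.2.2)
  rw [br_ι_E] at h1
  exact h1

variable (X) in
/-- The isomorphism `U(𝓛) ≅ B(𝓡)`. -/
noncomputable def ulEquivBR : UL X ≃ₐ[k] BR X :=
  AlgEquiv.ofAlgHom (ulLift (BR.ι X) (lieRel_br_ι X))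
    (brLift (Env.ι (lieBraiding X)) (lieRel_env_ι X))
    (br_hom_ext fun v => by simp [brLift_ι, ulLift_ι])
    (ul_hom_ext fun v => by simp [brLift_ι, ulLift_ι])

theorem ulEquivBR_ι (v : LieSpace X) : ulEquivBR X (Env.ι (lieBraiding X) v) = BR.ι X v :=
  ulLift_ι _ _ v

end Isomorphism

/-! ### From algebra morphisms Δ and ε to a braided bialgebra -/

section Builder

open GCrossedModule CrossedAlgebra

variable {k G A : Type*} [Field k] [Group G] [Fintype G] [DecidableEq G] [Ring A] [Algebra k A]

theorem tensor_ext₃ {U V W Z : Type*} [AddCommGroup U] [Module k U] [AddCommGroup V] [Module k V]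
    [AddCommGroup W] [Module k W] [AddCommGroup Z] [Module k Z]
    (L : GCrossedModule k G U) (M : GCrossedModule k G V) (N : GCrossedModule k G W)
    {f f' : U ⊗[k] (V ⊗[k] W) →ₗ[k] Z}
    (h : ∀ a b c u v w, L.IsHomog a u → M.IsHomog b v → N.IsHomog c w →
      f (u ⊗ₜ (v ⊗ₜ w)) = f' (u ⊗ₜ (v ⊗ₜ w))) : f = f' :=
  TensorProduct.ext (L.hom_ext fun a u hu => tensor_ext M N fun b c v w hv hw =>
    h a b c u v w hu hv hw)

section Braiding

variable (M : GCrossedModule k G A)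

theorem leg12_braiding {g : G} {a : A} (ha : M.IsHomog g a) (b c : A) :
    leg12 (M.braiding M) (a ⊗ₜ (b ⊗ₜ c)) = M.act g b ⊗ₜ (a ⊗ₜ c) := by
  simp [leg12, braiding_tmul ha]

theorem leg23_braiding {g : G} (a : A) {b : A} (hb : M.IsHomog g b) (c : A) :
    leg23 (M.braiding M) (a ⊗ₜ (b ⊗ₜ c)) = a ⊗ₜ (M.act g c ⊗ₜ b) := by
  simp [leg23, braiding_tmul hb]

/-- An element moved past two homogeneous factors is acted on by the product of their grades, so
only the total grade of x matters. Applied to x = Δa, this reduces compatibility of Δ with the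
braiding to Δ preserving grades. -/
theorem leg12_leg23_braiding {g : G} {x : A ⊗[k] A} (hx : (M.tensor M).IsHomog g x) (b : A) :
    leg12 (M.braiding M) (leg23 (M.braiding M) (TensorProduct.assoc k A A A (x ⊗ₜ b))) =
      M.act g b ⊗ₜ x := by
  refine tensor_homog_induction M M (p := fun x => leg12 (M.braiding M) (leg23 (M.braiding M)
    (TensorProduct.assoc k A A A (x ⊗ₜ b))) = M.act g b ⊗ₜ x) (fun g1 g2 a c ha hc e1 => ?_)
    (fun x y h h' => by simp only [TensorProduct.add_tmul, TensorProduct.tmul_add, map_add, h, h'])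
    x hx
  rw [TensorProduct.assoc_tmul, leg23_braiding M _ hc, leg12_braiding M ha, act_act, e1]

theorem leg23_leg12_braiding {g : G} {a : A} (ha : M.IsHomog g a) (x : A ⊗[k] A) :
    leg23 (M.braiding M) (leg12 (M.braiding M) (a ⊗ₜ x)) =
      TensorProduct.assoc k A A A ((M.tensor M).act g x ⊗ₜ a) := by
  induction x using TensorProduct.induction_on with
  | zero => simp only [map_zero, TensorProduct.tmul_zero, TensorProduct.zero_tmul]
  | add x y h h' => simp only [map_add, TensorProduct.tmul_add, TensorProduct.add_tmul, h, h']
  | tmul b c =>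
    rw [leg12_braiding M ha, leg23_braiding M _ ha, tensor_act_tmul, TensorProduct.assoc_tmul]

/-- The third factor is acted on by (ghg⁻¹)g on one side and by gh on the other, where g and h are
the grades of the first two. -/
theorem yang_baxter_braiding :
    leg12 (M.braiding M) ∘ₗ leg23 (M.braiding M) ∘ₗ leg12 (M.braiding M) =
      leg23 (M.braiding M) ∘ₗ leg12 (M.braiding M) ∘ₗ leg23 (M.braiding M) := by
  refine tensor_ext₃ M M M fun g h _ a b c ha hb _ => ?_
  simp only [LinearMap.comp_apply]
  rw [leg12_braiding M ha, leg23_braiding M _ ha, leg12_braiding M (hb.act g),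
    leg23_braiding M _ hb, leg12_braiding M ha, leg23_braiding M _ ha, act_act, act_act,
    inv_mul_cancel_right]

end Braiding

variable (C : CrossedAlgebra k G A)

theorem map_mul_middle (hC : C.mul = LinearMap.mul k A) (x y : A ⊗[k] A) :
    TensorProduct.map (LinearMap.mul' k A) (LinearMap.mul' k A)
      (middle (C.braiding C.toGCrossedModule) (x ⊗ₜ y)) = tensorMul C C x y := by
  induction x using tensor_induction C.toGCrossedModule C.toGCrossedModule with
  | hadd x x' h h' =>
    simp only [map_add, TensorProduct.add_tmul, LinearMap.add_apply, h, h']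
  | h g g' a b ha hb =>
  induction y using TensorProduct.induction_on with
  | zero => simp only [map_zero, TensorProduct.tmul_zero]
  | add x x' h h' => simp only [map_add, TensorProduct.tmul_add, h, h']
  | tmul c d =>
  rw [tensorMul_tmul a c hb, hC]
  simp [middle, leg12_braiding _ hb]

theorem proj_mul_eq_sum (hC : C.mul = LinearMap.mul k A) (g : G) (a b : A) :
    C.proj g (a * b) = ∑ h : G, C.proj h a * C.proj (h⁻¹ * g) b := by
  have h1 : C.proj g ∘ₗ LinearMap.mul' k A =
      LinearMap.mul' k A ∘ₗ tensorProj C.toGCrossedModule C.toGCrossedModule g := by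
    refine tensor_ext C.toGCrossedModule C.toGCrossedModule fun g1 g2 a b ha hb => ?_
    have h2 := C.homog_mul _ _ _ _ ha hb
    rw [hC] at h2
    rw [LinearMap.comp_apply, LinearMap.comp_apply, tensorProj_tmul ha hb, LinearMap.mul'_apply]
    refine (h2.proj_eq g).trans ?_
    split_ifs <;> simp
  have h2 := LinearMap.congr_fun h1 (a ⊗ₜ b)
  simpa [tensorProj] using h2

/-- The unit object is concentrated in grade 1. -/
theorem counit_eq_zero {ε : A →ₗ[k] k} (hε : IsCrossedHom C (CrossedAlgebra.trivial k G) ε)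
    {g : G} (hg : g ≠ 1) {a : A} (ha : C.IsHomog g a) : ε a = 0 := by
  have h1 := hε.map_homog g a ha
  simp only [CrossedAlgebra.trivial, GCrossedModule.IsHomog, GCrossedModule.trivial, if_neg hg]
    at h1
  exact h1.symm

/-- An algebra in the category of crossed modules with a coalgebra structure whose structure maps
are morphisms of such algebras is a bialgebra in the category of crossed modules. -/
noncomputable def GCrossedBialgebra.ofCrossedAlgebra (hC : C.mul = LinearMap.mul k A)
    (h1 : C.one = 1) (Δ : A →ₗ[k] A ⊗[k] A) (ε : A →ₗ[k] k)
    (hΔ : IsCrossedHom C (C.tensor C) Δ) (hε : IsCrossedHom C (CrossedAlgebra.trivial k G) ε)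
    (coassoc : (TensorProduct.assoc k A A A).toLinearMap ∘ₗ Δ.rTensor A ∘ₗ Δ = Δ.lTensor A ∘ₗ Δ)
    (counit_left : ε.rTensor A ∘ₗ Δ = TensorProduct.mk k k A 1)
    (counit_right : ε.lTensor A ∘ₗ Δ = (TensorProduct.mk k A k).flip 1) :
    GCrossedBialgebra k G A where
  comul := Δ
  counit := ε
  coassoc := coassoc
  rTensor_counit_comp_comul := counit_left
  lTensor_counit_comp_comul := counit_right
  braiding := C.braiding C.toGCrossedModule
  braiding_bijective := GCrossedModule.braiding_bijective _ _
  yang_baxter := yang_baxter_braiding _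
  braiding_mul_left := tensor_ext₃ C.toGCrossedModule C.toGCrossedModule C.toGCrossedModule
    fun g h _ a b c ha hb _ => by
      have h2 := C.homog_mul _ _ _ _ ha hb
      rw [hC] at h2
      simp only [LinearMap.comp_apply]
      rw [leg23_braiding _ _ hb, leg12_braiding _ ha, act_act]
      simp only [mul12, mul23, LinearMap.comp_apply, LinearEquiv.coe_coe,
        TensorProduct.assoc_symm_tmul, LinearMap.rTensor_tmul, LinearMap.lTensor_tmul,
        LinearMap.mul'_apply]
      exact braiding_tmul h2 c
  braiding_mul_right := tensor_ext₃ C.toGCrossedModule C.toGCrossedModule C.toGCrossedModule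
    fun g h _ a b c ha hb _ => by
      have h2 := C.act_mul g b c
      rw [hC] at h2
      simp only [LinearMap.comp_apply]
      rw [leg12_braiding _ ha, leg23_braiding _ _ ha]
      simp only [mul12, mul23, LinearMap.comp_apply, LinearEquiv.coe_coe,
        TensorProduct.assoc_symm_tmul, LinearMap.rTensor_tmul, LinearMap.lTensor_tmul,
        LinearMap.mul'_apply]
      rw [braiding_tmul ha]
      exact congrArg (· ⊗ₜ a) h2
  braiding_one_left a := by
    rw [← h1, braiding_tmul C.homog_one, act_one]
  braiding_one_right a := by
    rw [← h1]
    induction a using C.toGCrossedModule.homog_induction with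
    | hadd v w h h' => simp only [map_add, TensorProduct.add_tmul, TensorProduct.tmul_add, h, h']
    | h0 g v hv => rw [braiding_tmul hv, C.act_algebra_one]
  comul_left_braiding := tensor_ext C.toGCrossedModule C.toGCrossedModule
    fun g _ a b ha _ => by
      simp only [LinearMap.comp_apply, comul12, comul23, LinearMap.rTensor_tmul,
        LinearEquiv.coe_coe]
      rw [braiding_tmul ha, leg12_leg23_braiding _ (hΔ.map_homog g a ha), LinearMap.lTensor_tmul]
  comul_right_braiding := tensor_ext C.toGCrossedModule C.toGCrossedModule
    fun g _ a b ha _ => by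
      simp only [LinearMap.comp_apply, comul12, comul23, LinearMap.lTensor_tmul,
        LinearEquiv.coe_coe]
      rw [braiding_tmul ha, leg23_leg12_braiding _ ha, LinearMap.rTensor_tmul, hΔ.map_act]
      rfl
  counit_left_braiding := tensor_ext C.toGCrossedModule C.toGCrossedModule
    fun g _ a b ha _ => by
      simp only [LinearMap.comp_apply, counit1, counit2, LinearEquiv.coe_coe]
      rw [braiding_tmul ha]
      simp only [LinearMap.rTensor_tmul, LinearMap.lTensor_tmul, TensorProduct.lid_tmul,
        TensorProduct.rid_tmul]
      -- In grade 1 the braiding does not act on b; in every other grade ε(a) = 0 and both sides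
      -- vanish.
      by_cases hg : g = 1
      · rw [hg, act_one]
      · rw [counit_eq_zero C hε hg ha, zero_smul, zero_smul]
  counit_right_braiding := tensor_ext C.toGCrossedModule C.toGCrossedModule
    fun g _ a b ha _ => by
      simp only [LinearMap.comp_apply, counit1, counit2, LinearEquiv.coe_coe]
      rw [braiding_tmul ha]
      simp only [LinearMap.rTensor_tmul, LinearMap.lTensor_tmul, TensorProduct.lid_tmul,
        TensorProduct.rid_tmul, hε.map_act]
      rfl
  comul_mul := TensorProduct.ext' fun a b => by
    simp only [LinearMap.comp_apply, TensorProduct.map_tmul, LinearMap.mul'_apply]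
    rw [map_mul_middle C hC]
    have h2 := hΔ.map_mul a b
    rw [hC] at h2
    exact h2
  comul_one := by
    have h2 := hΔ.map_one
    rw [h1] at h2
    simpa [CrossedAlgebra.tensor, h1] using h2
  counit_mul a b := by
    have h2 := hε.map_mul a b
    rw [hC] at h2
    exact h2
  counit_one := by
    have h2 := hε.map_one
    rwa [h1] at h2
  act := C.act
  proj := C.proj
  proj_mul_proj := C.proj_mul_proj
  sum_proj := C.sum_proj
  act_mul_proj := C.act_mul_proj
  braiding_eq := rfl
  act_algebra_mul h a b := by
    have h2 := C.act_mul h a b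
    rw [hC] at h2
    exact h2
  act_algebra_one h := by rw [← h1, C.act_algebra_one]
  proj_algebra_mul := proj_mul_eq_sum C hC
  proj_algebra_one g := by
    have h2 := C.homog_one.proj_eq g
    rwa [h1] at h2
  comul_act h := LinearMap.ext fun a => hΔ.map_act h a
  comul_proj g := by
    refine Eq.trans (b := tensorProj C.toGCrossedModule C.toGCrossedModule g ∘ₗ Δ) ?_
      (LinearMap.ext fun a => by simp [tensorProj])
    refine C.toGCrossedModule.hom_ext fun h a ha => ?_
    refine Eq.trans ?_ ((hΔ.map_homog h a ha).proj_eq g).symm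
    rw [LinearMap.comp_apply, ha.proj_eq]
    split_ifs <;> simp
  counit_act h := LinearMap.ext fun a => hε.map_act h a
  counit_proj g := by
    refine C.toGCrossedModule.hom_ext fun h a ha => ?_
    rw [LinearMap.comp_apply, ha.proj_eq]
    by_cases hg : g = 1
    · rw [if_pos hg]
      by_cases hh : h = 1
      · rw [if_pos (hg.trans hh.symm)]
      · rw [counit_eq_zero C hε hh ha, if_neg (fun h3 => hh (h3.symm.trans hg)), map_zero]
    · rw [if_neg hg]
      split_ifs with hh
      · rw [counit_eq_zero C hε (hh ▸ hg) ha]; rfl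
      · simp

end Builder

/-! ### Equivariance of the coproduct, counit and relations on generators -/

section Comul

variable {k G σ : Type*} [Field k] [Group G] [Fintype G] [DecidableEq G] {X : σ → Block k G}

theorem lieComul_lowerAct (h : G) (v : LieSpace X) :
    lieComul X (lowerAct X h v) = TensorProduct.map (lowerAct X h) LinearMap.id (lieComul X v) := by
  refine LinearMap.congr_fun (f := lieComul X ∘ₗ lowerAct X h)
    (g := TensorProduct.map (lowerAct X h) LinearMap.id ∘ₗ lieComul X)
    (lieSpace_hom_ext fun s x y => ?_) v
  simp only [LinearMap.comp_apply, lieComul_E, lowerAct_E, map_sum, map_smul,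
    TensorProduct.map_tmul, TensorProduct.sum_tmul, LinearMap.id_apply, Finset.smul_sum,
    TensorProduct.smul_tmul']
  rw [Finset.sum_comm]

theorem lieComul_upperAct (h : G) (v : LieSpace X) :
    lieComul X (upperAct X h v) = TensorProduct.map LinearMap.id (upperAct X h) (lieComul X v) := by
  refine LinearMap.congr_fun (f := lieComul X ∘ₗ upperAct X h)
    (g := TensorProduct.map LinearMap.id (upperAct X h) ∘ₗ lieComul X)
    (lieSpace_hom_ext fun s x y => ?_) v
  simp only [LinearMap.comp_apply, lieComul_E, upperAct_E, map_sum, map_smul,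
    TensorProduct.map_tmul, TensorProduct.tmul_sum, LinearMap.id_apply, Finset.smul_sum,
    TensorProduct.tmul_smul]
  rw [Finset.sum_comm]

/-- The lower action of h passes to the first tensor factor and the upper action to the second. The
missing halves may be inserted on the contracted indices, where they act trivially. -/
theorem lieComul_lieAct (h : G) (v : LieSpace X) :
    lieComul X (lieAct X h v) = TensorProduct.map (lieAct X h) (lieAct X h) (lieComul X v) := by
  have h1 : ∀ t : LieSpace X ⊗[k] LieSpace X, TensorProduct.map (lowerAct X h) LinearMap.id
      (TensorProduct.map LinearMap.id (upperAct X h)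
        (TensorProduct.map (upperAct X h) (lowerAct X h) t)) =
      TensorProduct.map (lieAct X h) (lieAct X h) t := by
    intro t
    induction t using TensorProduct.induction_on with
    | zero => simp only [map_zero]
    | add x y h h' => simp only [map_add, h, h']
    | tmul x y => simp only [TensorProduct.map_tmul, lieAct_eq, lowerAct_upperAct,
        LinearMap.id_apply]
  rw [← h1, upperAct_lowerAct_comul, lieAct_eq, lieComul_lowerAct, lieComul_upperAct]

/-- The counit is the evaluation pairing of V with V*, across which a matrix can be moved. -/
theorem lieCounit_lowerAct (h : G) (v : LieSpace X) :
    lieCounit X (lowerAct X h v) = lieCounit X (upperAct X h⁻¹ v) := by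
  refine LinearMap.congr_fun (f := lieCounit X ∘ₗ lowerAct X h)
    (g := lieCounit X ∘ₗ upperAct X h⁻¹) (lieSpace_hom_ext fun s x y => ?_) v
  simp [lieCounit_E, upperAct_E, lowerAct_E]

theorem lieCounit_lieAct (h : G) (v : LieSpace X) : lieCounit X (lieAct X h v) = lieCounit X v := by
  rw [lieAct_eq, lieCounit_lowerAct, upperAct_mul, inv_mul_cancel, upperAct_one]

theorem lieCounit_eq_zero {g : G} (hg : g ≠ 1) {v : LieSpace X}
    (hv : (lieCrossed X).IsHomog g v) : lieCounit X v = 0 := by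
  rw [← hv]
  refine LinearMap.congr_fun (f := lieCounit X ∘ₗ lieProj X g) (g := 0)
    (lieSpace_hom_ext fun s x y => ?_) v
  rw [LinearMap.comp_apply, lieProj_E]
  split_ifs with h
  · rw [lieCounit_E, if_neg]
    · rfl
    · rintro rfl
      exact hg (by rw [← h, mul_inv_cancel])
  · simp

theorem isHomog_lieComul {g : G} {v : LieSpace X} (hv : (lieCrossed X).IsHomog g v) :
    ((lieCrossed X).tensor (lieCrossed X)).IsHomog g (lieComul X v) := by
  rw [← hv]
  refine LinearMap.congr_fun
    (f := ((lieCrossed X).tensor (lieCrossed X)).proj g ∘ₗ lieComul X ∘ₗ lieProj X g)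
    (g := lieComul X ∘ₗ lieProj X g) (lieSpace_hom_ext fun s x y => ?_) v
  rw [LinearMap.comp_apply, LinearMap.comp_apply, lieProj_E]
  split_ifs with h
  · rw [lieComul_E, map_sum]
    refine Finset.sum_congr rfl fun z _ => ?_
    have h1 := (isHomog_E s x z).tmul (isHomog_E s z y)
    rwa [show (x.1 : G) * (z.1 : G)⁻¹ * (z.1 * (y.1 : G)⁻¹) = g by rw [← h]; group] at h1
  · simp

theorem lowerAct_lieAct (g h : G) (v : LieSpace X) :
    lowerAct X g (lieAct X h v) = lowerAct X (g * h) (upperAct X h v) := by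
  rw [lieAct_eq, lowerAct_mul]

/-- Applying h conjugates both group elements in the relation, and (hch⁻¹)h = hc, (h|j|h⁻¹)h = h|j|.
-/
theorem LieRel.comp_lieAct {B : Type*} [Ring B] [Algebra k B] {g : LieSpace X →ₗ[k] B}
    (hg : LieRel g) (h : G) : LieRel (g ∘ₗ lieAct X h) := by
  intro s i j c y hy
  simp only [LinearMap.comp_apply]
  have hx : upperProj X (h * j.1 * h⁻¹) (lieAct X h (E X s i j)) = lieAct X h (E X s i j) := by
    rw [upperProj_lieAct, upperProj_E, if_pos rfl]
  rw [hg.of_upper hx (isHomog_lieAct hy h), lowerAct_lieAct, inv_mul_cancel_right, lieAct_lieAct,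
    lieAct_lieAct, inv_mul_cancel_right, lieAct_eq h (lowerAct X c _), ← lowerAct_upperAct,
    lowerAct_mul]

end Comul

/-! ### The action and grading on the enveloping algebra -/

section Enveloping

variable {k G σ : Type*} [Field k] [Group G] [Fintype G] [DecidableEq G] {X : σ → Block k G}
  {A B : Type*} [Ring A] [Algebra k A] [Ring B] [Algebra k B] (e : A ≃ₐ[k] UL X)

/-- The canonical map of `𝓛` to an algebra identified with `U(𝓛)`. -/
noncomputable def genMap : LieSpace X →ₗ[k] A :=
  e.symm.toLinearMap ∘ₗ Env.ι (lieBraiding X)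

theorem LieRel.algHom_comp {g : LieSpace X →ₗ[k] A} (hg : LieRel g) (F : A →ₐ[k] B) :
    LieRel (F.toLinearMap ∘ₗ g) := fun s i j c y hy => by
  simpa using congrArg F (hg s i j c y hy)

theorem lieRel_genMap : LieRel (genMap e) := (lieRel_env_ι X).algHom_comp e.symm.toAlgHom

/-- The universal property. -/
noncomputable def genLift (g : LieSpace X →ₗ[k] B) (hg : LieRel g) : A →ₐ[k] B :=
  (ulLift g hg).comp e.toAlgHom

theorem genLift_genMap (g : LieSpace X →ₗ[k] B) (hg : LieRel g) (v : LieSpace X) :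
    genLift e g hg (genMap e v) = g v := by
  simp [genLift, genMap, ulLift_ι]

theorem gen_hom_ext {F F' : A →ₐ[k] B} (h : ∀ v, F (genMap e v) = F' (genMap e v)) : F = F' := by
  have h1 : F.comp e.symm.toAlgHom = F'.comp e.symm.toAlgHom := ul_hom_ext h
  ext a
  simpa using DFunLike.congr_fun h1 (e a)

theorem gen_induction {p : A → Prop} (halg : ∀ r, p (algebraMap k A r))
    (hgen : ∀ v, p (genMap e v)) (hmul : ∀ a b, p a → p b → p (a * b))
    (hadd : ∀ a b, p a → p b → p (a + b)) (a : A) : p a := by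
  obtain ⟨t, ht⟩ := RingQuot.mkAlgHom_surjective k (EnvRel (lieBraiding X)) (e a)
  rw [← e.symm_apply_apply a, ← ht]
  clear ht
  induction t using TensorAlgebra.induction with
  | algebraMap r => simpa using halg r
  | ι v => exact hgen v
  | mul a b h h' => rw [map_mul, map_mul]; exact hmul _ _ h h'
  | add a b h h' => rw [map_add, map_add]; exact hadd _ _ h h'

/-- Every element is a sum of elements with a property of homogeneous elements that holds for the
homogeneous generators and is preserved by products. -/
theorem gen_graded_induction {p : G → A → Prop} (halg : ∀ r, p 1 (algebraMap k A r))
    (hgen : ∀ g v, (lieCrossed X).IsHomog g v → p g (genMap e v))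
    (hmul : ∀ g h a b, p g a → p h b → p (g * h) (a * b)) (a : A) :
    a ∈ AddSubmonoid.closure {a : A | ∃ g, p g a} := by
  -- The elements with the property are closed under products, hence so is the additive submonoid
  -- that they generate.
  let S : Subsemigroup A :=
    { carrier := {a : A | ∃ g, p g a}
      mul_mem' := fun ⟨g, ha⟩ ⟨h, hb⟩ => ⟨g * h, hmul g h _ _ ha hb⟩ }
  have hS : ∀ a b : A, a ∈ AddSubmonoid.closure (S : Set A) → b ∈ AddSubmonoid.closure (S : Set A) →
      a * b ∈ AddSubmonoid.closure (S : Set A) := fun a b ha hb =>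
    MulMemClass.mul_mem_add_closure ha hb
  change a ∈ AddSubmonoid.closure (S : Set A)
  refine gen_induction e (p := fun a => a ∈ AddSubmonoid.closure (S : Set A))
    (fun r => AddSubmonoid.subset_closure ⟨1, halg r⟩) (fun v => ?_) hS
    (fun a b => add_mem) a
  induction v using (lieCrossed X).homog_induction with
  | h0 g v hv => exact AddSubmonoid.subset_closure ⟨g, hgen g v hv⟩
  | hadd v w h h' => rw [map_add]; exact add_mem h h'

/-- Linear maps agreeing on the elements with such a property are equal. -/
theorem gen_graded_ext {M : Type*} [AddCommMonoid M] [Module k M] {p : G → A → Prop}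
    (hp : ∀ a : A, a ∈ AddSubmonoid.closure {a : A | ∃ g, p g a}) {F F' : A →ₗ[k] M}
    (h : ∀ g a, p g a → F a = F' a) : F = F' := by
  refine LinearMap.ext fun a => ?_
  induction hp a using AddSubmonoid.closure_induction with
  | mem a ha => obtain ⟨g, ha⟩ := ha; exact h g a ha
  | zero => rw [map_zero, map_zero]
  | add a b _ _ h h' => rw [map_add, map_add, h, h']

/-- The action of a group element. -/
noncomputable def genAct (h : G) : A →ₐ[k] A :=
  genLift e (genMap e ∘ₗ lieAct X h) ((lieRel_genMap e).comp_lieAct h)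

theorem genAct_genMap (h : G) (v : LieSpace X) :
    genAct e h (genMap e v) = genMap e (lieAct X h v) := genLift_genMap e _ _ v

/-- The linear map `a ↦ a g` to the group algebra with coefficients in `A`. -/
noncomputable def groupSingle (k : Type*) [Field k] {A : Type*} [Ring A] [Algebra k A] (g : G) :
    A →ₗ[k] MonoidAlgebra A G :=
  (MonoidAlgebra.coeffLinearEquiv k).symm.toLinearMap ∘ₗ Finsupp.lsingle g

theorem groupSingle_apply (g : G) (a : A) : groupSingle k g a = MonoidAlgebra.single g a := rfl

/-- The grading as a map `𝓛 → A[G]` on generators. -/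
noncomputable def gradeMap : LieSpace X →ₗ[k] MonoidAlgebra A G :=
  ∑ g : G, groupSingle k g ∘ₗ genMap e ∘ₗ lieProj X g

theorem gradeMap_apply {g : G} {v : LieSpace X} (hv : (lieCrossed X).IsHomog g v) :
    gradeMap e v = MonoidAlgebra.single g (genMap e v) := by
  rw [gradeMap, LinearMap.sum_apply, Finset.sum_eq_single g]
  · simp only [LinearMap.comp_apply, groupSingle_apply]
    rw [show lieProj X g v = v from hv]
  · intro h _ hh
    simp only [LinearMap.comp_apply]
    rw [show lieProj X h v = 0 from (hv.proj_eq h).trans (if_neg hh), map_zero, map_zero]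
  · exact fun h => absurd (Finset.mem_univ _) h

/-- The relations are homogeneous: (c|i|c⁻¹|j|⁻¹)(|j|c|j|⁻¹) = c|i||j|⁻¹. -/
theorem lieRel_gradeMap : LieRel (gradeMap e) := by
  intro s i j c y hy
  rw [gradeMap_apply e hy, gradeMap_apply e (isHomog_E s i j),
    gradeMap_apply e (isHomog_lowerAct_E c s i j), gradeMap_apply e (isHomog_lieAct hy j.1),
    MonoidAlgebra.single_mul_single, MonoidAlgebra.single_mul_single,
    lieRel_genMap e s i j c y hy]
  congr 1
  group

/-- The coaction `A → A[G]` of the grading. -/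
noncomputable def genCoact : A →ₐ[k] MonoidAlgebra A G :=
  genLift e (gradeMap e) (lieRel_gradeMap e)

theorem genCoact_genMap {g : G} {v : LieSpace X} (hv : (lieCrossed X).IsHomog g v) :
    genCoact e (genMap e v) = MonoidAlgebra.single g (genMap e v) :=
  (genLift_genMap e _ _ v).trans (gradeMap_apply e hv)

/-- The projection to a component of the grading. -/
noncomputable def genProj (g : G) : Module.End k A :=
  Finsupp.lapply g ∘ₗ (MonoidAlgebra.coeffLinearEquiv k).toLinearMap ∘ₗ (genCoact e).toLinearMap

theorem genProj_eq {g : G} {a : A} (ha : genCoact e a = MonoidAlgebra.single g a) (h : G) :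
    genProj e h a = if h = g then a else 0 := by
  change (genCoact e a).coeff h = _
  rw [ha, MonoidAlgebra.coeff_single, Finsupp.single_apply]
  simp only [eq_comm]

theorem genAct_one (a : A) : genAct e 1 a = a := by
  refine DFunLike.congr_fun (g := AlgHom.id k A) (gen_hom_ext e fun v => ?_) a
  rw [genAct_genMap, lieAct_one]; rfl

theorem genAct_mul (g h : G) (a : A) : genAct e (g * h) a = genAct e g (genAct e h a) := by
  refine DFunLike.congr_fun (g := (genAct e g).comp (genAct e h)) (gen_hom_ext e fun v => ?_) a
  rw [AlgHom.comp_apply, genAct_genMap, genAct_genMap, genAct_genMap, lieAct_lieAct]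

/-- The translates by all h are part of the property, so that a single induction yields both the
grading and its compatibility with the action; h = 1 gives back plain homogeneity. -/
theorem mem_closure_homog (a : A) : a ∈ AddSubmonoid.closure {a : A | ∃ g : G, ∀ h : G,
    genCoact e (genAct e h a) = MonoidAlgebra.single (h * g * h⁻¹) (genAct e h a)} := by
  refine gen_graded_induction e (fun r h => ?_) (fun g v hv h => ?_) (fun g g' a b ha hb h => ?_) a
  · simp
  · rw [genAct_genMap, genCoact_genMap e (isHomog_lieAct hv h)]
  · rw [map_mul, map_mul, ha, hb, MonoidAlgebra.single_mul_single]
    congr 1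
    group

theorem coact_of_homog {g : G} {a : A}
    (ha : ∀ h : G, genCoact e (genAct e h a) = MonoidAlgebra.single (h * g * h⁻¹) (genAct e h a)) :
    genCoact e a = MonoidAlgebra.single g a := by
  have h1 := ha 1
  rwa [genAct_one, one_mul, inv_one, mul_one] at h1

theorem genCoact_genProj (g : G) (a : A) :
    genCoact e (genProj e g a) = MonoidAlgebra.single g (genProj e g a) := by
  refine LinearMap.congr_fun (f := (genCoact e).toLinearMap ∘ₗ genProj e g)
    (g := groupSingle k g ∘ₗ genProj e g) (gen_graded_ext (mem_closure_homog e) fun h a ha => ?_) a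
  rw [LinearMap.comp_apply, LinearMap.comp_apply, genProj_eq e (coact_of_homog e ha)]
  split_ifs with h1
  · rw [AlgHom.toLinearMap_apply, coact_of_homog e ha, groupSingle_apply, h1]
  · rw [map_zero, map_zero]

/-- The crossed module structure on an algebra identified with `U(𝓛)`. -/
noncomputable def genCrossed : GCrossedModule k G A where
  act :=
    { toFun := fun h => (genAct e h).toLinearMap
      map_one' := LinearMap.ext fun a => genAct_one e a
      map_mul' := fun g h => LinearMap.ext fun a => genAct_mul e g h a }
  proj := genProj e
  proj_mul_proj g h := by
    refine gen_graded_ext (mem_closure_homog e) fun g0 a ha => ?_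
    have h1 := coact_of_homog e ha
    rw [Module.End.mul_apply, genProj_eq e h1]
    by_cases hg : h = g0
    · rw [if_pos hg]
      split_ifs with h2
      · rfl
      · rw [genProj_eq e h1, if_neg (fun h3 => h2 (h3.trans hg.symm))]; rfl
    · rw [if_neg hg, map_zero]
      split_ifs with h2
      · rw [genProj_eq e h1, if_neg (fun h3 => hg (h2.symm.trans h3))]
      · rfl
  sum_proj := by
    refine gen_graded_ext (mem_closure_homog e) fun g0 a ha => ?_
    rw [LinearMap.sum_apply]
    simp [genProj_eq e (coact_of_homog e ha)]
  act_mul_proj h g := by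
    refine gen_graded_ext (mem_closure_homog e) fun g0 a ha => ?_
    rw [Module.End.mul_apply, Module.End.mul_apply, genProj_eq e (coact_of_homog e ha)]
    simp only [MonoidHom.coe_mk, OneHom.coe_mk, AlgHom.toLinearMap_apply]
    rw [genProj_eq e (ha h)]
    have h1 : h * g * h⁻¹ = h * g0 * h⁻¹ ↔ g = g0 := by simp
    simp only [h1]
    split_ifs <;> simp

/-- Since the coaction is an algebra map, this form of homogeneity is visibly preserved by products.
-/
theorem genCrossed_isHomog {g : G} {a : A} :
    (genCrossed e).IsHomog g a ↔ genCoact e a = MonoidAlgebra.single g a := by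
  constructor
  · intro h
    rw [← h]
    exact genCoact_genProj e g a
  · intro h
    exact (genProj_eq e h g).trans (if_pos rfl)

/-- An algebra identified with `U(𝓛)` as an algebra in the category of crossed modules. -/
noncomputable def genAlgebra : CrossedAlgebra k G A where
  toGCrossedModule := genCrossed e
  mul := LinearMap.mul k A
  one := 1
  mul_assoc a b c := mul_assoc a b c
  one_mul := one_mul
  mul_one := mul_one
  act_mul h a b := map_mul (genAct e h) a b
  act_algebra_one h := map_one (genAct e h)
  homog_mul g h a b ha hb := by
    rw [genCrossed_isHomog] at *
    rw [LinearMap.mul_apply', map_mul, ha, hb, MonoidAlgebra.single_mul_single]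
  homog_one := by
    rw [genCrossed_isHomog, map_one, MonoidAlgebra.one_def]

theorem isHomog_genMap {g : G} {v : LieSpace X} (hv : (lieCrossed X).IsHomog g v) :
    (genAlgebra e).IsHomog g (genMap e v) :=
  (genCrossed_isHomog e).2 (genCoact_genMap e hv)

theorem genAlgebra_act_genMap (h : G) (v : LieSpace X) :
    (genAlgebra e).act h (genMap e v) = genMap e (lieAct X h v) := genAct_genMap e h v

theorem isHomog_algebraMap (r : k) : (genAlgebra e).IsHomog 1 (algebraMap k A r) := by
  refine (genCrossed_isHomog e).2 ?_
  rw [AlgHom.commutes]; rfl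

end Enveloping

/-! ### Extending maps of generators to morphisms of crossed algebras -/

section Extension

open GCrossedModule CrossedAlgebra

variable {k G σ : Type*} [Field k] [Group G] [Fintype G] [DecidableEq G] {X : σ → Block k G}
  {A B W : Type*} [Ring A] [Algebra k A] [Ring B] [Algebra k B] [AddCommGroup W] [Module k W]
  (e : A ≃ₐ[k] UL X) (e' : B ≃ₐ[k] UL X)

/-- The coalgebra axioms, and the compatibility of the isomorphism with Δ and ε, are equations
between such morphisms and so reduce to generators. -/
theorem isCrossedHom_unique {D : CrossedAlgebra k G W} {F F' : A →ₗ[k] W}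
    (hF : IsCrossedHom (genAlgebra e) D F) (hF' : IsCrossedHom (genAlgebra e) D F')
    (h : ∀ v, F (genMap e v) = F' (genMap e v)) : F = F' := by
  refine LinearMap.ext fun a => ?_
  induction a using gen_induction e with
  | halg r =>
    rw [Algebra.algebraMap_eq_smul_one, map_smul, map_smul]
    exact congrArg _ (hF.map_one.trans hF'.map_one.symm)
  | hgen v => exact h v
  | hmul a b h1 h2 =>
    refine (hF.map_mul a b).trans (Eq.trans ?_ (hF'.map_mul a b).symm)
    rw [h1, h2]
  | hadd a b h1 h2 => rw [map_add, map_add, h1, h2]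

/-- The left multiplications by the values of a linear map on the generators. -/
noncomputable def mulMap (D : CrossedAlgebra k G W) (φ : LieSpace X →ₗ[k] W) :
    LieSpace X →ₗ[k] Module.End k W :=
  D.mul ∘ₗ φ

theorem mulMap_mul (D : CrossedAlgebra k G W) (φ : LieSpace X →ₗ[k] W) (x y : LieSpace X) :
    mulMap D φ x * mulMap D φ y = D.mul (D.mul (φ x) (φ y)) :=
  LinearMap.ext fun z => (D.mul_assoc (φ x) (φ y) z).symm

/-- The extension of a linear map of `𝓛` to an algebra map to a braided algebra. -/
noncomputable def genExtend (D : CrossedAlgebra k G W) (φ : LieSpace X →ₗ[k] W)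
    (hφ : LieRel (mulMap D φ)) : A →ₗ[k] W :=
  LinearMap.applyₗ D.one ∘ₗ (genLift e (mulMap D φ) hφ).toLinearMap

section

variable {D : CrossedAlgebra k G W} {φ : LieSpace X →ₗ[k] W} (hφ : LieRel (mulMap D φ))

theorem genExtend_apply (a : A) :
    genExtend e D φ hφ a = genLift e (mulMap D φ) hφ a D.one := rfl

theorem genExtend_genMap (v : LieSpace X) : genExtend e D φ hφ (genMap e v) = φ v := by
  rw [genExtend_apply, genLift_genMap]
  exact D.mul_one _

/-- The universal property needs a ring as target, so it is applied to left multiplications in End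
W. The operator attached to a is again a left multiplication, by its value at the unit, and hence
evaluation at the unit loses nothing and is multiplicative. -/
theorem mul_genExtend (a : A) : D.mul (genExtend e D φ hφ a) = genLift e (mulMap D φ) hφ a := by
  induction a using gen_induction e with
  | halg r =>
    ext z
    rw [genExtend_apply, AlgHom.commutes]
    simp [Module.algebraMap_end_apply, D.one_mul]
  | hgen v => rw [genExtend_genMap, genLift_genMap]; rfl
  | hmul a b h1 h2 =>
    rw [genExtend_apply, map_mul, ← h1, ← h2]
    ext z
    simp only [Module.End.mul_apply]
    rw [D.mul_one, D.mul_assoc]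
  | hadd a b h1 h2 => simp only [map_add, h1, h2]

theorem genExtend_mul (a b : A) :
    genExtend e D φ hφ (a * b) = D.mul (genExtend e D φ hφ a) (genExtend e D φ hφ b) := by
  rw [mul_genExtend, genExtend_apply, map_mul]; rfl

theorem genExtend_algebraMap (r : k) :
    genExtend e D φ hφ (algebraMap k A r) = r • D.one := by
  rw [genExtend_apply, AlgHom.commutes, Module.algebraMap_end_apply]

theorem isCrossedHom_genExtend (hact : ∀ h v, φ (lieAct X h v) = D.act h (φ v))
    (hhom : ∀ g v, (lieCrossed X).IsHomog g v → D.IsHomog g (φ v)) :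
    IsCrossedHom (genAlgebra e) D (genExtend e D φ hφ) where
  map_mul := genExtend_mul e hφ
  map_one := by
    have := genExtend_algebraMap e hφ 1
    rwa [map_one, one_smul] at this
  map_act h a := by
    change genExtend e D φ hφ (genAct e h a) = _
    induction a using gen_induction e with
    | halg r =>
      rw [AlgHom.commutes, genExtend_algebraMap, map_smul, D.act_algebra_one]
    | hgen v => rw [genAct_genMap, genExtend_genMap, genExtend_genMap, hact]
    | hmul a b h1 h2 => rw [map_mul, genExtend_mul, genExtend_mul, h1, h2, D.act_mul]
    | hadd a b h1 h2 => simp only [map_add, h1, h2]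
  map_homog g a ha := by
    -- Preservation of grades is expressed as commuting with projections, a linear identity that can
    -- be tested on products of homogeneous generators.
    have h1 : D.proj g ∘ₗ genExtend e D φ hφ = genExtend e D φ hφ ∘ₗ (genAlgebra e).proj g := by
      refine gen_graded_ext (p := fun g a => (genAlgebra e).IsHomog g a ∧
        D.IsHomog g (genExtend e D φ hφ a)) (gen_graded_induction e (fun r => ?_)
          (fun g v hv => ?_) fun g h a b ha hb => ?_) fun h a ha => ?_
      · refine ⟨isHomog_algebraMap e r, ?_⟩
        rw [genExtend_algebraMap, IsHomog, map_smul, D.homog_one]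
      · rw [genExtend_genMap]
        exact ⟨isHomog_genMap e hv, hhom g v hv⟩
      · rw [genExtend_mul]
        exact ⟨(genAlgebra e).homog_mul _ _ _ _ ha.1 hb.1, D.homog_mul _ _ _ _ ha.2 hb.2⟩
      · rw [LinearMap.comp_apply, LinearMap.comp_apply, ha.2.proj_eq, ha.1.proj_eq]
        split_ifs <;> simp
    have h2 := LinearMap.congr_fun h1 a
    rw [LinearMap.comp_apply, LinearMap.comp_apply, ha] at h2
    exact h2

end

/-! ### The coproduct and counit on the enveloping algebra -/

/-- The coproduct of the generators. -/
noncomputable def comulMap : LieSpace X →ₗ[k] A ⊗[k] A :=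
  TensorProduct.map (genMap e) (genMap e) ∘ₗ lieComul X

theorem comulMap_lieAct (h : G) (v : LieSpace X) : comulMap e (lieAct X h v) =
    TensorProduct.map (genMap e ∘ₗ lieAct X h) (genMap e ∘ₗ lieAct X h) (lieComul X v) := by
  rw [comulMap, LinearMap.comp_apply, lieComul_lieAct, TensorProduct.map_comp]; rfl

theorem comulMap_lowerAct (h : G) (v : LieSpace X) : comulMap e (lowerAct X h v) =
    TensorProduct.map (genMap e ∘ₗ lowerAct X h) (genMap e) (lieComul X v) := by
  have h1 : TensorProduct.map (genMap e ∘ₗ lowerAct X h) (genMap e ∘ₗ LinearMap.id) =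
    TensorProduct.map (genMap e) (genMap e) ∘ₗ TensorProduct.map (lowerAct X h) LinearMap.id :=
    TensorProduct.map_comp _ _ _ _
  rw [LinearMap.comp_id] at h1
  rw [comulMap, LinearMap.comp_apply, lieComul_lowerAct, h1]; rfl

theorem upperProj_upperProj (b c : G) (v : LieSpace X) :
    upperProj X b (upperProj X c v) = if b = c then upperProj X c v else 0 := by
  refine LinearMap.congr_fun (f := upperProj X b ∘ₗ upperProj X c)
    (g := if b = c then upperProj X c else 0) (lieSpace_hom_ext fun s x y => ?_) v |>.trans ?_
  · rw [LinearMap.comp_apply, upperProj_E]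
    split_ifs with h1 h2 h2
    · rw [upperProj_E, if_pos (h1.trans h2.symm), upperProj_E, if_pos h1]
    · rw [upperProj_E, if_neg (fun h3 => h2 (h3.symm.trans h1))]; rfl
    · rw [map_zero, upperProj_E, if_neg h1]
    · simp
  · split_ifs <;> rfl

/-- The linear map `v ↦ (c ▷ v) (b ▷ y)` for `v` of upper grade `b`, where `c` acts on the lower
index of `v`. -/
noncomputable def mulUpper (c : G) (y : LieSpace X) : LieSpace X →ₗ[k] A :=
  ∑ b : G, LinearMap.mulRight k (genMap e (lieAct X b y)) ∘ₗ genMap e ∘ₗ lowerAct X c ∘ₗ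
    upperProj X b

theorem mulUpper_apply (c : G) (y : LieSpace X) {b : G} {v : LieSpace X}
    (hv : upperProj X b v = v) :
    mulUpper e c y v = genMap e (lowerAct X c v) * genMap e (lieAct X b y) := by
  rw [mulUpper, LinearMap.sum_apply, Finset.sum_eq_single b]
  · rw [LinearMap.comp_apply, LinearMap.comp_apply, LinearMap.comp_apply, hv,
      LinearMap.mulRight_apply]
  · intro b' _ hb'
    rw [LinearMap.comp_apply, LinearMap.comp_apply, LinearMap.comp_apply, ← hv,
      upperProj_upperProj, if_neg hb', map_zero, map_zero, map_zero]
  · exact fun h => absurd (Finset.mem_univ _) h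

/-- Moving y past h ▷ x acts by gh on the lower index of x and by h on the upper one, and y is then
acted on by the new upper grade hbh⁻¹. So everything is a function of the upper translate of x
alone. -/
theorem mul_genMap_lieAct {g h b : G} {x y : LieSpace X} (hx : upperProj X b x = x)
    (hy : (lieCrossed X).IsHomog g y) :
    genMap e y * genMap e (lieAct X h x) = mulUpper e (g * h) y (upperAct X h x) := by
  rw [mulUpper_apply e (g * h) y (b := h * b * h⁻¹) (by rw [upperProj_upperAct, hx]),
    (lieRel_genMap e).of_upper (b := h * b * h⁻¹) (by rw [upperProj_lieAct, hx]) hy,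
    lowerAct_lieAct]

theorem genAlgebra_mul (a b : A) : (genAlgebra e).mul a b = a * b := rfl

theorem tensorMul_comulMap_left {s : σ} (i j : (X s).Idx) {g h : G} {y y' : LieSpace X}
    (hy : (lieCrossed X).IsHomog g y) (hy' : (lieCrossed X).IsHomog h y') :
    tensorMul (genAlgebra e) (genAlgebra e) (genMap e y ⊗ₜ genMap e y')
      (TensorProduct.map (genMap e) (genMap e) (lieComul X (E X s i j))) =
    TensorProduct.map (mulUpper e (g * h) y)
      (LinearMap.mulRight k (genMap e (lieAct X j.1 y')) ∘ₗ genMap e)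
      (lieComul X (E X s i j)) := by
  rw [lieComul_E, map_sum, map_sum]
  -- The braided product puts the upper action of h on the contracted index of the first factor, and
  -- the relation for y' puts its lower action on that of the second. Together they leave the
  -- coproduct unchanged, so they are inserted on the right.
  conv_rhs => rw [← lieComul_E, ← upperAct_lowerAct_comul h (E X s i j), lieComul_E, map_sum,
    map_sum]
  refine Finset.sum_congr rfl fun z _ => ?_
  rw [TensorProduct.map_tmul, TensorProduct.map_tmul, TensorProduct.map_tmul,
    tensorMul_tmul _ _ (isHomog_genMap e hy'), genAlgebra_act_genMap, genAlgebra_mul,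
    genAlgebra_mul, mul_genMap_lieAct e (b := z.1) (by rw [upperProj_E, if_pos rfl]) hy,
    lieRel_genMap e s z j _ _ hy']
  rfl

/-- Passing E_z^j acts by |z||j|⁻¹ and turns |j| ▷ y into |z| ▷ y, where |z| is the upper grade of
the first leg, as `mulUpper` requires. -/
theorem tensorMul_comulMap_right {s : σ} (i j : (X s).Idx) (c : G) (y y' : LieSpace X) :
    tensorMul (genAlgebra e) (genAlgebra e)
      (TensorProduct.map (genMap e ∘ₗ lowerAct X c) (genMap e) (lieComul X (E X s i j)))
      (genMap e (lieAct X j.1 y) ⊗ₜ genMap e (lieAct X j.1 y')) =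
    TensorProduct.map (mulUpper e c y)
      (LinearMap.mulRight k (genMap e (lieAct X j.1 y')) ∘ₗ genMap e)
      (lieComul X (E X s i j)) := by
  rw [lieComul_E, map_sum, map_sum, map_sum, LinearMap.sum_apply]
  refine Finset.sum_congr rfl fun z _ => ?_
  rw [TensorProduct.map_tmul, TensorProduct.map_tmul,
    tensorMul_tmul _ _ (isHomog_genMap e (isHomog_E s z j)), genAlgebra_act_genMap,
    genAlgebra_mul, genAlgebra_mul, lieAct_lieAct, inv_mul_cancel_right,
    mulUpper_apply e c y (b := z.1) (by rw [upperProj_E, if_pos rfl])]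
  rfl

/-- Both sides reduce to the same expression for each label p contracted in ΔE_a^l, because the
grades of the two legs multiply to (|a||p|⁻¹)(|p||l|⁻¹) = |a||l|⁻¹. -/
theorem tensorMul_comulMap (s t : σ) (i j : (X s).Idx) (a l : (X t).Idx) :
    tensorMul (genAlgebra e) (genAlgebra e) (comulMap e (E X t a l)) (comulMap e (E X s i j)) =
    tensorMul (genAlgebra e) (genAlgebra e)
      (comulMap e (lowerAct X ((a.1 : G) * (l.1 : G)⁻¹) (E X s i j)))
      (comulMap e (lieAct X j.1 (E X t a l))) := by
  rw [comulMap_lieAct, comulMap_lowerAct, comulMap, LinearMap.comp_apply, LinearMap.comp_apply,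
    lieComul_E t, map_sum, map_sum, map_sum, map_sum, LinearMap.sum_apply]
  refine Finset.sum_congr rfl fun p _ => ?_
  rw [TensorProduct.map_tmul, TensorProduct.map_tmul,
    tensorMul_comulMap_left e i j (isHomog_E t a p) (isHomog_E t p l), LinearMap.comp_apply,
    LinearMap.comp_apply, tensorMul_comulMap_right]
  congr 3
  group

theorem lieRel_comulMap :
    LieRel (mulMap ((genAlgebra e).tensor (genAlgebra e)) (comulMap e)) := by
  refine LieRel.of_basis fun s t i j a l => ?_
  rw [mulMap_mul, mulMap_mul]
  exact congrArg _ (tensorMul_comulMap e s t i j a l)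

/-- The coproduct extending the one of `𝓛`. -/
noncomputable def genComul : A →ₗ[k] A ⊗[k] A :=
  genExtend e _ _ (lieRel_comulMap e)

theorem genComul_genMap (v : LieSpace X) :
    genComul e (genMap e v) = TensorProduct.map (genMap e) (genMap e) (lieComul X v) :=
  genExtend_genMap e _ v

theorem isHomog_map_genMap {g : G} {x : LieSpace X ⊗[k] LieSpace X}
    (hx : ((lieCrossed X).tensor (lieCrossed X)).IsHomog g x) :
    ((genAlgebra e).tensor (genAlgebra e)).IsHomog g
      (TensorProduct.map (genMap e) (genMap e) x) := by
  refine tensor_homog_induction (lieCrossed X) (lieCrossed X)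
    (p := fun x => ((genAlgebra e).tensor (genAlgebra e)).IsHomog g
      (TensorProduct.map (genMap e) (genMap e) x)) (fun g1 g2 a b ha hb e1 => ?_)
    (fun x x' h h' => by rw [map_add, IsHomog, map_add, h, h']) x hx
  rw [← e1]
  exact (isHomog_genMap e ha).tmul (isHomog_genMap e hb)

theorem isCrossedHom_genComul :
    IsCrossedHom (genAlgebra e) ((genAlgebra e).tensor (genAlgebra e)) (genComul e) := by
  refine isCrossedHom_genExtend e _ (fun h v => ?_) fun g v hv =>
    isHomog_map_genMap e (isHomog_lieComul hv)
  rw [comulMap_lieAct, comulMap, LinearMap.comp_apply]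
  generalize lieComul X v = x
  induction x using TensorProduct.induction_on with
  | zero => simp only [map_zero]
  | add x y h h' => simp only [map_add, h, h']
  | tmul x y =>
    rw [TensorProduct.map_tmul, TensorProduct.map_tmul]
    change _ = (genAlgebra e).act h _ ⊗ₜ (genAlgebra e).act h _
    rw [genAlgebra_act_genMap, genAlgebra_act_genMap]
    rfl

/-- In grade 1 the relation is commutativity of k; in every other grade the counit of y vanishes,
also after the action. -/
theorem lieRel_lieCounit : LieRel (mulMap (CrossedAlgebra.trivial k G) (lieCounit X)) := by
  intro s i j c y hy
  rw [mulMap_mul, mulMap_mul, lieCounit_lieAct]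
  by_cases hc : c = 1
  · rw [hc, lowerAct_one]
    exact congrArg _ (mul_comm _ _)
  · rw [lieCounit_eq_zero hc hy]
    simp

/-- The counit extending the one of `𝓛`. -/
noncomputable def genCounit : A →ₗ[k] k :=
  genExtend e _ _ lieRel_lieCounit

theorem genCounit_genMap (v : LieSpace X) : genCounit e (genMap e v) = lieCounit X v :=
  genExtend_genMap e _ v

theorem isCrossedHom_genCounit :
    IsCrossedHom (genAlgebra e) (CrossedAlgebra.trivial k G) (genCounit e) := by
  refine isCrossedHom_genExtend e _ (fun h v => lieCounit_lieAct h v) fun g v hv => ?_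
  by_cases hg : g = 1
  · simp [IsHomog, CrossedAlgebra.trivial, GCrossedModule.trivial, hg]
  · rw [lieCounit_eq_zero hg hv, IsHomog, map_zero]

theorem genComul_E (s : σ) (x y : (X s).Idx) : genComul e (genMap e (E X s x y)) =
    ∑ z, genMap e (E X s x z) ⊗ₜ genMap e (E X s z y) := by
  simp only [genComul_genMap, lieComul_E, map_sum, TensorProduct.map_tmul]

theorem genComul_coassoc : (TensorProduct.assoc k A A A).toLinearMap ∘ₗ
    (genComul e).rTensor A ∘ₗ genComul e = (genComul e).lTensor A ∘ₗ genComul e := by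
  have hΔ := isCrossedHom_genComul e
  refine isCrossedHom_unique e
    ((isCrossedHom_assoc _ _ _).comp ((hΔ.tensor (IsCrossedHom.id _)).comp hΔ))
    (((IsCrossedHom.id _).tensor hΔ).comp hΔ) fun v => ?_
  refine LinearMap.congr_fun (f := ((TensorProduct.assoc k A A A).toLinearMap ∘ₗ
    (genComul e).rTensor A ∘ₗ genComul e) ∘ₗ genMap e)
    (g := ((genComul e).lTensor A ∘ₗ genComul e) ∘ₗ genMap e) (lieSpace_hom_ext fun s x y => ?_) v
  simp only [LinearMap.comp_apply, genComul_E, map_sum, LinearMap.rTensor_tmul,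
    LinearMap.lTensor_tmul, TensorProduct.sum_tmul, TensorProduct.tmul_sum, LinearEquiv.coe_coe,
    TensorProduct.assoc_tmul]
  rw [Finset.sum_comm]

theorem genCounit_rTensor :
    (genCounit e).rTensor A ∘ₗ genComul e = TensorProduct.mk k k A 1 := by
  refine isCrossedHom_unique e
    (((isCrossedHom_genCounit e).tensor (IsCrossedHom.id _)).comp (isCrossedHom_genComul e))
    (isCrossedHom_one_tmul (CrossedAlgebra.trivial k G) (genAlgebra e)) fun v => ?_
  refine LinearMap.congr_fun (f := ((genCounit e).rTensor A ∘ₗ genComul e) ∘ₗ genMap e)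
    (g := TensorProduct.mk k k A 1 ∘ₗ genMap e) (lieSpace_hom_ext fun s x y => ?_) v
  simp only [LinearMap.comp_apply, genComul_E, map_sum, LinearMap.rTensor_tmul,
    genCounit_genMap, lieCounit_E, TensorProduct.mk_apply]
  rw [Finset.sum_eq_single x]
  · simp
  · intro z _ hz
    rw [if_neg hz.symm, TensorProduct.zero_tmul]
  · exact fun h => absurd (Finset.mem_univ _) h

theorem genCounit_lTensor :
    (genCounit e).lTensor A ∘ₗ genComul e = (TensorProduct.mk k A k).flip 1 := by
  refine isCrossedHom_unique e
    (((IsCrossedHom.id _).tensor (isCrossedHom_genCounit e)).comp (isCrossedHom_genComul e))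
    (isCrossedHom_tmul_one (genAlgebra e) (CrossedAlgebra.trivial k G)) fun v => ?_
  refine LinearMap.congr_fun (f := ((genCounit e).lTensor A ∘ₗ genComul e) ∘ₗ genMap e)
    (g := (TensorProduct.mk k A k).flip 1 ∘ₗ genMap e) (lieSpace_hom_ext fun s x y => ?_) v
  simp only [LinearMap.comp_apply, genComul_E, map_sum, LinearMap.lTensor_tmul,
    genCounit_genMap, lieCounit_E, TensorProduct.mk_apply, LinearMap.flip_apply]
  rw [Finset.sum_eq_single y]
  · simp
  · intro z _ hz
    rw [if_neg hz, TensorProduct.tmul_zero]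
  · exact fun h => absurd (Finset.mem_univ _) h

/-! ### The bialgebras, their isomorphism and the braiding of braided matrices -/

/-- The structure of a bialgebra in the category of crossed modules on an algebra identified with
`U(𝓛)`. -/
noncomputable def genBialgebra : GCrossedBialgebra k G A :=
  GCrossedBialgebra.ofCrossedAlgebra (genAlgebra e) rfl rfl (genComul e) (genCounit e)
    (isCrossedHom_genComul e) (isCrossedHom_genCounit e) (genComul_coassoc e)
    (genCounit_rTensor e) (genCounit_lTensor e)

theorem extendsLie_genBialgebra : ExtendsLie X (genMap e) (genBialgebra e) where
  act h := LinearMap.ext fun v => genAlgebra_act_genMap e h v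
  proj g := by
    refine (lieCrossed X).hom_ext fun h v hv => ?_
    refine ((isHomog_genMap e hv).proj_eq g).trans ?_
    rw [LinearMap.comp_apply, show lieProj X g v = if g = h then v else 0 from hv.proj_eq g]
    split_ifs <;> simp
  comul := LinearMap.ext fun v => genComul_genMap e v
  counit := LinearMap.ext fun v => genCounit_genMap e v

/-- An algebra map is the extension of its values on generators, and the extension of equivariant,
grade-preserving values is already a morphism in the category. -/
theorem isCrossedHom_algEquiv (Φ : A ≃ₐ[k] B) (hΦ : ∀ v, Φ (genMap e v) = genMap e' v) :
    IsCrossedHom (genAlgebra e) (genAlgebra e') Φ.toLinearMap := by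
  have hrel : LieRel (mulMap (genAlgebra e') (genMap e')) :=
    (lieRel_genMap e').algHom_comp (Algebra.lmul k B)
  have h1 := isCrossedHom_genExtend e hrel (fun h v => (genAlgebra_act_genMap e' h v).symm)
    fun g v hv => isHomog_genMap e' hv
  have h2 : Φ.toLinearMap = genExtend e _ _ hrel := by
    refine LinearMap.ext fun a => ?_
    induction a using gen_induction e with
    | halg r =>
      rw [genExtend_algebraMap, AlgEquiv.toLinearMap_apply, AlgEquiv.commutes,
        Algebra.algebraMap_eq_smul_one]
      rfl
    | hgen v => rw [genExtend_genMap]; exact hΦ v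
    | hmul a b h1 h2 =>
      rw [genExtend_mul, ← h1, ← h2]; exact map_mul Φ a b
    | hadd a b h1 h2 => rw [map_add, map_add, h1, h2]
  rwa [h2]

theorem isCrossedBialgebraIso_algEquiv (Φ : A ≃ₐ[k] B)
    (hΦ : ∀ v, Φ (genMap e v) = genMap e' v) :
    IsCrossedBialgebraIso (genBialgebra e) (genBialgebra e') Φ := by
  have h1 := isCrossedHom_algEquiv e e' Φ hΦ
  refine ⟨fun h a => h1.map_act h a, fun g a => ?_, fun a => ?_, fun a => ?_, fun x => ?_⟩
  · refine LinearMap.congr_fun (f := Φ.toLinearMap ∘ₗ (genAlgebra e).proj g)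
      (g := (genAlgebra e').proj g ∘ₗ Φ.toLinearMap)
      ((genAlgebra e).toGCrossedModule.hom_ext fun h a ha => ?_) a
    rw [LinearMap.comp_apply, LinearMap.comp_apply, ha.proj_eq, (h1.map_homog h a ha).proj_eq]
    split_ifs <;> simp
  · refine LinearMap.congr_fun (isCrossedHom_unique e ((h1.tensor h1).comp (isCrossedHom_genComul e))
      ((isCrossedHom_genComul e').comp h1) fun v => ?_) a
    have h2 : Φ.toLinearMap ∘ₗ genMap e = genMap e' := LinearMap.ext hΦ
    simp only [LinearMap.comp_apply, genComul_genMap, AlgEquiv.toLinearMap_apply, hΦ]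
    rw [← LinearMap.comp_apply, ← TensorProduct.map_comp, h2]
  · refine LinearMap.congr_fun (isCrossedHom_unique e (isCrossedHom_genCounit e)
      ((isCrossedHom_genCounit e').comp h1) fun v => ?_) a
    simp only [LinearMap.comp_apply, AlgEquiv.toLinearMap_apply, hΦ, genCounit_genMap]
  · refine LinearMap.congr_fun
      (f := TensorProduct.map Φ.toLinearMap Φ.toLinearMap ∘ₗ
        (genAlgebra e).braiding (genAlgebra e).toGCrossedModule)
      (g := (genAlgebra e').braiding (genAlgebra e').toGCrossedModule ∘ₗ
        TensorProduct.map Φ.toLinearMap Φ.toLinearMap)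
      (tensor_ext (genAlgebra e).toGCrossedModule (genAlgebra e).toGCrossedModule
        fun g _ a b ha _ => ?_) x
    rw [LinearMap.comp_apply, LinearMap.comp_apply, braiding_tmul ha, TensorProduct.map_tmul,
      TensorProduct.map_tmul, braiding_tmul (h1.map_homog g a ha), h1.map_act]

theorem genMap_ulEquivBR : genMap (ulEquivBR X).symm = BR.ι X :=
  LinearMap.ext fun v => ulEquivBR_ι v

/-- The first and last factors multiply to ρ(|i||j|⁻¹) on the lower index and the middle two to
ρ((|i||j|⁻¹)⁻¹) on the upper one. These are the coefficients of E_i^j's grade acting on E_m^l, that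
is, of the crossed-module braiding. -/
theorem sum_braiding_coeff (s t : σ) (i j v n : (X s).Idx) (m l p q : (X t).Idx) :
    (∑ a : (X s).Idx, ∑ b : (X t).Idx, ∑ c : (X s).Idx, ∑ d : (X t).Idx,
      rMatrix X s t a i p d * rInv (rMatrix X) s t v a b q * rMatrix X s t c n l b *
        rHat (rMatrix X) s t j c d m) =
    if v = i then (if n = j then (X t).rep ((i.1 : G) * (j.1 : G)⁻¹) p m *
      (X t).rep ((i.1 : G) * (j.1 : G)⁻¹)⁻¹ l q else 0) else 0 := by
  simp only [rMatrix_eq, rInv_rMatrix, rHat_rMatrix]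
  rw [Finset.sum_eq_single i (fun a _ ha => by simp [ha]) (by simp)]
  have h1 : ∀ F : (X s).Idx → (X t).Idx → k,
      (∑ c, ∑ d, F c d * (if j = c then (X t).rep (j.1 : G)⁻¹ d m else 0)) =
      ∑ d, F j d * (X t).rep (j.1 : G)⁻¹ d m := by
    intro F
    rw [Finset.sum_eq_single j (fun a _ ha => by simp [ha.symm]) (by simp)]
    simp
  simp only [h1]
  by_cases hv : v = i
  swap
  · simp [hv]
  by_cases hn : n = j
  swap
  · simp [hn, Ne.symm hn]
  subst hv hn
  simp only [if_true, map_mul, mul_inv_rev, inv_inv, Matrix.mul_apply, Finset.sum_mul_sum]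
  rw [Finset.sum_comm]
  refine Finset.sum_congr rfl fun d _ => Finset.sum_congr rfl fun b _ => ?_
  ring

theorem isBraidedMatrixBialgebra_genBialgebra : IsBraidedMatrixBialgebra (rMatrix X)
    (genBialgebra (ulEquivBR X).symm).toBraidedBialgebra where
  comul_u s i j := by
    have h := genComul_E (ulEquivBR X).symm s i j
    simp only [genMap_ulEquivBR, br_ι_E] at h
    exact h
  counit_u s i j := by
    have h := genCounit_genMap (ulEquivBR X).symm (E X s i j)
    rw [genMap_ulEquivBR, br_ι_E, lieCounit_E] at h
    exact h
  braiding_u s t i j m l := by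
    have h := braiding_tmul (M := (genAlgebra (ulEquivBR X).symm).toGCrossedModule)
      (N := (genAlgebra (ulEquivBR X).symm).toGCrossedModule)
      (isHomog_genMap (ulEquivBR X).symm (isHomog_E s i j))
      (genMap (ulEquivBR X).symm (E X t m l))
    rw [genAlgebra_act_genMap, genMap_ulEquivBR, br_ι_E, br_ι_E] at h
    refine h.trans ?_
    simp only [sum_braiding_coeff, ite_smul, zero_smul, Finset.sum_ite_eq', Finset.mem_univ,
      if_true, Finset.sum_ite_irrel, Finset.sum_const_zero]
    rw [lieAct_eq, upperAct_E, map_sum, map_sum, TensorProduct.sum_tmul, Finset.sum_comm]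
    refine Finset.sum_congr rfl fun q _ => ?_
    rw [map_smul, map_smul, lowerAct_E, map_sum, Finset.smul_sum, TensorProduct.sum_tmul]
    refine Finset.sum_congr rfl fun p _ => ?_
    rw [map_smul, br_ι_E, smul_smul, TensorProduct.smul_tmul', mul_comm]

end Extension

end BraidedDouble

open BraidedDouble in
/-- For every family of blocks `V_{𝒞,π}` of the quantum double (one block, or a direct sum), the
R-matrix of `D^∨(G)` is the explicit one and is bi-invertible, the braided enveloping algebra
`U(𝓛)` and the braided matrices `B(𝓡)` are bialgebras in the category of `G`-crossed modules, the
latter with the structure of the braided-matrix bialgebra, and `E_x^y ↦ u_x^y` is an isomorphism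
between them. -/
theorem mainTheorem12 {k G σ : Type*} [Field k] [Group G] [Fintype G] [DecidableEq G]
    (X : σ → Block k G) :
    (∀ (s t : σ) (a b : (X s).Idx) (c d : (X t).Idx), rMatrix X s t a b c d =
      if a = b ∧ (c.1 : G) = (a.1 : G) * d.1 * (a.1 : G)⁻¹ then
        (X t).π ((X t).ζ d.1 a.1) c.2 d.2 else 0) ∧
    IsBiinvertible (rMatrix X) ∧
    ∃ (DU : GCrossedBialgebra k G (UL X)) (DB : GCrossedBialgebra k G (BR X)),
      ExtendsLie X (Env.ι (lieBraiding X)) DU ∧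
      ExtendsLie X (BR.ι X) DB ∧
      IsBraidedMatrixBialgebra (rMatrix X) DB.toBraidedBialgebra ∧
      ∃ Φ : UL X ≃ₐ[k] BR X,
        (∀ v : LieSpace X, Φ (Env.ι (lieBraiding X) v) = BR.ι X v) ∧
        IsCrossedBialgebraIso DU DB Φ := by
  -- One construction is used twice: for U(𝓛) with the identity, and for B(𝓡) with the inverse of
  -- the isomorphism. The isomorphism then matches the two generating maps by definition.
  refine ⟨rMatrix_eq' X, isBiinvertible_rMatrix X, genBialgebra AlgEquiv.refl,
    genBialgebra (ulEquivBR X).symm, extendsLie_genBialgebra AlgEquiv.refl, ?_,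
    isBraidedMatrixBialgebra_genBialgebra, ulEquivBR X, ulEquivBR_ι,
    isCrossedBialgebraIso_algEquiv _ _ _ fun _ => rfl⟩
  rw [← genMap_ulEquivBR]
  exact extendsLie_genBialgebra (ulEquivBR X).symm
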